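/- **Setting.** A *gridded permutation* is a permutation whose plot is divided into four quadrants (numbered anticlockwise from the top right) by one vertical and one horizontal line, taken as the coordinate axes; its length is its number of points. Containment $\sigma\le\tau$ of gridded permutations means that $\sigma$ is order isomorphic to a subset of the points of $\tau$ by a map that preserves quadrants. A *class* is a set of gridded permutations closed downwards under containment. The *box sum* $\sigma\boxplus\tau$ is obtained by inserting a copy of $\sigma$ at the origin of a copy of $\tau$; a class is *box closed* if it contains $\sigma\boxplus\tau$ for all its members $\sigma,\tau$, and the *box closure* $\boxplus\mathcal D$ of a set $\mathcal D$ is the smallest box-closed class containing $\mathcal D$. The growth rate of a class $\mathcal C$ is $\mathrm{gr}(\mathcal C)=\lim_{n\to\infty}|\mathcal C_n|^{1/n}$, if this limit exists, where $\mathcal C_n$ is the set of members of $\mathcal C$ of length $n$. A *pin word* is a word over $\{\mathsf l_{\mathsf u},\mathsf l_{\mathsf d},\mathsf r_{\mathsf u},\mathsf r_{\mathsf d},\mathsf u_{\mathsf l},\mathsf u_{\mathsf r},\mathsf d_{\mathsf l},\mathsf d_{\mathsf r}\}$ in which the subscript of each letter except the first is the main symbol of the preceding letter; an infinite pin word is a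 *pin sequence*. A pin word $w=w_1w_2\cdots$ defines a gridded pin permutation $\pi_w$ with points $p_1,p_2,\dots$: the point $p_1$ lies in the quadrant given by the two directions in $w_1$, and for $i\ge2$ the point $p_i$ lies outside the rectangular hull of the origin and $p_1,\dots,p_{i-1}$, in the direction (left, right, up, down) given by the main symbol of $w_i$, and separates $p_{i-1}$ from the origin and all of $p_1,\dots,p_{i-2}$. The *pin class* $\mathcal C_w$ of a pin sequence $w$ is the set of all finite gridded permutations contained in $\pi_w$. A finite factor of an infinite word is *recurrent* if it appears infinitely often. An infinite word is *recurrent* if all its finite factors are recurrent, and *eventually recurrent* if deleting some finite prefix leaves a recurrent word. The *box-interior* of $\mathcal C_w$ is $$\mathcal C_w^{\boxplus}=\boxplus\{\sigma\in\mathcal C_w:\sigma\le\pi_u\text{ for some recurrent factor }u\text{ of }w\}.$$ Let $\phi$ be the map from binary words to pin words given by $\phi(0)=\mathsf l_{\mathsf u}\mathsf u_{\mathsf l}$ and $\phi(1)=\mathsf r_{\mathsf u}\mathsf u_{\mathsf r}$. Let $b^\star=10\,110\,1110\,11110\cdots$ be the limit of the words $b^{(1)}=10$, $b^{(i)}=b^{(i-1)}1^i0$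 $(i\ge2)$, and let $w^\star=\phi(b^\star)$. Let $\mu\approx3.28277$ be the largest real zero of $z^5-4z^4+3z^3-2z^2-z+2$. **Proposition.** The word $w^\star$ is a pin sequence that is neither recurrent nor eventually recurrent. The box-interior of its pin class satisfies $\mathcal C_{w^\star}^{\boxplus}\subseteq\mathcal C_{w^\star}$ and $$\mathcal C_{w^\star}^{\boxplus}=\boxplus\left\{\pi_f : f\text{ is a factor of }\phi(1^k01^\ell)\text{ for some }k,\ell\ge0\right\},$$ where, with subscripts suppressed, $\phi(1^k01^\ell)=(\mathsf r\mathsf u)^k\,\mathsf l\mathsf u\,(\mathsf r\mathsf u)^\ell$. Moreover the growth rate of $\mathcal C_{w^\star}$ exists, and $\mathrm{gr}(\mathcal C_{w^\star})=\mu$. -/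

import Mathlib

namespace Pin

/-! ### Gridded permutations in the 2 × 2 grid -/

/-- A permutation of length `len` whose plot is divided by one vertical and one horizontal line.
`vert` is the number of points to the left of the vertical line and `horiz` the number of points
below the horizontal line; these two numbers determine, and are determined by, the contents of
the four cells. -/
structure GridPerm where
  len : ℕ
  perm : Equiv.Perm (Fin len)
  vert : Fin (len + 1)
  horiz : Fin (len + 1)

/-- The plot of a gridded permutation, drawn (with odd integer coordinates) so that the two lines
are the coordinate axes. -/
def GridPerm.plot (σ : GridPerm) (i : Fin σ.len) : ℤ × ℤ :=
  (2 * (i : ℕ) + 1 - 2 * (σ.vert : ℕ), 2 * (σ.perm i : ℕ) + 1 - 2 * (σ.horiz : ℕ))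

/-- `σ` is contained, as a gridded permutation, in the family of points `p` of the plane gridded
by the two coordinate axes: there is an embedding that preserves the left-to-right order, the
bottom-to-top order, and the cells. -/
def GridPerm.EmbedsIn {ι : Type*} (σ : GridPerm) (p : ι → ℤ × ℤ) : Prop :=
  ∃ f : Fin σ.len → ι,
    (∀ i j : Fin σ.len, i < j ↔ (p (f i)).1 < (p (f j)).1) ∧
    (∀ i j : Fin σ.len, σ.perm i < σ.perm j ↔ (p (f i)).2 < (p (f j)).2) ∧
    (∀ i : Fin σ.len, (i : ℕ) < (σ.vert : ℕ) ↔ (p (f i)).1 < 0) ∧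
    (∀ i : Fin σ.len, (σ.perm i : ℕ) < (σ.horiz : ℕ) ↔ (p (f i)).2 < 0)

/-- Containment of gridded permutations. -/
instance : LE GridPerm := ⟨fun σ τ => σ.EmbedsIn τ.plot⟩

/-- The gridded permutation formed by finitely many points of the plane gridded by the coordinate
axes. (It is used only for points with pairwise distinct abscissae and pairwise distinct
ordinates, none of them on an axis.) `Tuple.sort` of the abscissae lists the points from left to
right, and the inverse of `Tuple.sort` of the ordinates returns the rank of a point from the
bottom. -/
def ofPoints {n : ℕ} (p : Fin n → ℤ × ℤ) : GridPerm where
  len := n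
  perm := (Tuple.sort fun i => (p i).1).trans (Tuple.sort fun i => (p i).2).symm
  vert := ⟨(Finset.univ.filter fun i => (p i).1 < 0).card,
    Nat.lt_succ_of_le ((Finset.card_le_univ _).trans_eq (Fintype.card_fin n))⟩
  horiz := ⟨(Finset.univ.filter fun i => (p i).2 < 0).card,
    Nat.lt_succ_of_le ((Finset.card_le_univ _).trans_eq (Fintype.card_fin n))⟩

/-- Move a coordinate away from `0` by `d`. -/
def pushOut (d x : ℤ) : ℤ := if x < 0 then x - d else x + d

/-- The box sum `σ ⊞ τ`: a copy of `σ` is inserted at the origin of a copy of `τ`. All coordinates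
in the plot of `σ` have absolute value less than `2 * σ.len`, so that the points of `τ`, pushed
outwards by this amount in both coordinates, surround those of `σ`. -/
def boxSum (σ τ : GridPerm) : GridPerm :=
  ofPoints (Fin.append σ.plot fun j =>
    (pushOut (2 * σ.len) (τ.plot j).1, pushOut (2 * σ.len) (τ.plot j).2))

/-- A class of gridded permutations: a set closed under containment. -/
def IsGridClass (C : Set GridPerm) : Prop := ∀ σ ∈ C, ∀ τ : GridPerm, τ ≤ σ → τ ∈ C

/-- A set of gridded permutations is box closed if it contains all box sums of its members. -/
def BoxClosed (C : Set GridPerm) : Prop := ∀ σ ∈ C, ∀ τ ∈ C, boxSum σ τ ∈ C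

/-- The box closure of `D`: the smallest box-closed class that contains `D`. -/
def boxClosure (D : Set GridPerm) : Set GridPerm :=
  ⋂₀ {C | IsGridClass C ∧ BoxClosed C ∧ D ⊆ C}

/-- The set `C` has growth rate `g`: the `n`-th root of the number of members of `C` of length `n`
tends to `g`. -/
def HasGrowthRate (C : Set GridPerm) (g : ℝ) : Prop :=
  Filter.Tendsto (fun n : ℕ => ({σ ∈ C | σ.len = n}.ncard : ℝ) ^ (1 / (n : ℝ)))
    Filter.atTop (nhds g)

/-! ### Combinatorics of words -/

/-- The finite word `f` appears in the infinite word `w` at position `i`. -/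
def OccursAt {α : Type*} (f : List α) (w : ℕ → α) (i : ℕ) : Prop :=
  ∀ (j : ℕ) (hj : j < f.length), w (i + j) = f[j]

/-- `f` is a (finite) factor of `w`. -/
def IsFactor {α : Type*} (f : List α) (w : ℕ → α) : Prop := ∃ i, OccursAt f w i

/-- `f` is a recurrent factor of `w`: it appears infinitely often. -/
def IsRecurrentFactor {α : Type*} (f : List α) (w : ℕ → α) : Prop := {i | OccursAt f w i}.Infinite

/-- An infinite word is recurrent if each of its finite factors appears infinitely often. -/
def Recurrent {α : Type*} (w : ℕ → α) : Prop := ∀ f, IsFactor f w → IsRecurrentFactor f w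

/-- An infinite word is eventually recurrent if deleting some finite initial segment leaves a
recurrent word. -/
def EventuallyRecurrent {α : Type*} (w : ℕ → α) : Prop := ∃ N : ℕ, Recurrent fun n => w (N + n)

/-! ### Pin words and pin permutations -/

/-- The four directions left, right, up, down. -/
inductive Dir where
  | l | r | u | d

/-- The alphabet of the memory encoding: the first letter of a name is the direction of the pin,
the second one that of the previous pin. For an initial pin the two directions say in which
quadrant it lies. -/
inductive PinLetter where
  | lu | ld | ru | rd | ul | ur | dl | dr

/-- The direction of the pin. -/
def PinLetter.dir : PinLetter → Dir
  | lu | ld => .l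
  | ru | rd => .r
  | ul | ur => .u
  | dl | dr => .d

/-- The direction of the previous pin. -/
def PinLetter.prev : PinLetter → Dir
  | lu | ru => .u
  | ld | rd => .d
  | ul | dl => .l
  | ur | dr => .r

/-- An infinite pin word (pin sequence): each letter remembers the direction of its predecessor. -/
def IsPinSequence (w : ℕ → PinLetter) : Prop := ∀ i, (w (i + 1)).prev = (w i).dir

/-- The `i`-th pin (counted from `0`). In its own direction it lies at distance `2 * i + 4` from
the origin, hence beyond all earlier pins. In the direction of the previous pin it lies at
distance `2 * i + 1`: for `i ≥ 1` this is between the previous pin, at distance `2 * i + 2`, and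
the origin together with all pins before that, which are at distance at most `2 * i`. -/
def pinPoint (i : ℕ) : PinLetter → ℤ × ℤ
  | .lu => (-(2 * i + 4), 2 * i + 1)
  | .ld => (-(2 * i + 4), -(2 * i + 1))
  | .ru => (2 * i + 4, 2 * i + 1)
  | .rd => (2 * i + 4, -(2 * i + 1))
  | .ul => (-(2 * i + 1), 2 * i + 4)
  | .ur => (2 * i + 1, 2 * i + 4)
  | .dl => (-(2 * i + 1), -(2 * i + 4))
  | .dr => (2 * i + 1, -(2 * i + 4))

/-- The gridded pin permutation of a finite pin word. -/
def pinPerm (f : List PinLetter) : GridPerm := ofPoints fun i : Fin f.length => pinPoint i (f.get i)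

/-- The pin class of a pin sequence `w`: all finite gridded permutations contained in the infinite
gridded pin permutation of `w`. -/
def pinClass (w : ℕ → PinLetter) : Set GridPerm :=
  {σ | σ.EmbedsIn fun i : ℕ => pinPoint i (w i)}

/-- The box-interior of the pin class of `w`: the box closure of the set of those members that
are contained in the pin permutation of a recurrent factor. -/
def boxInterior (w : ℕ → PinLetter) : Set GridPerm :=
  boxClosure {σ ∈ pinClass w | ∃ u, IsRecurrentFactor u w ∧ σ ≤ pinPerm u}

/-! ### From binary words to pin words -/

/-- The images of the two binary letters: `0 ↦ l u` and `1 ↦ r u` (`true` stands for `1`). -/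
def phiLetter : Bool → List PinLetter
  | false => [.lu, .ul]
  | true => [.ru, .ur]

/-- The pin word of a finite binary word. -/
def phi (a : List Bool) : List PinLetter := a.flatMap phiLetter

theorem mod_two_lt_length_phiLetter (x : Bool) (n : ℕ) : n % 2 < (phiLetter x).length := by
  cases x <;> exact Nat.mod_lt _ Nat.two_pos

/-- The pin sequence of an infinite binary word. -/
def phiSeq (b : ℕ → Bool) (n : ℕ) : PinLetter :=
  (phiLetter (b (n / 2)))[n % 2]'(mod_two_lt_length_phiLetter _ n)

/-- The finite words `b⁽ⁱ⁾`: `b⁽⁰⁾` is empty and `b⁽ⁱ⁺¹⁾ = b⁽ⁱ⁾ 1ⁱ⁺¹ 0`, so that `b⁽¹⁾ = 10`. -/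
def bApprox : ℕ → List Bool
  | 0 => []
  | i + 1 => bApprox i ++ List.replicate (i + 1) true ++ [false]

theorem le_length_bApprox (n : ℕ) : n ≤ (bApprox n).length := by
  induction n with
  | zero => simp
  | succ k ih => simp only [bApprox, List.length_append, List.length_replicate,
      List.length_singleton]; omega

/-- The limit `b⋆ = 10 110 1110 11110 ⋯` of the words `b⁽ⁱ⁾`, each of which begins the next one. -/
def bStar (n : ℕ) : Bool := (bApprox (n + 1))[n]'(le_length_bApprox (n + 1))

/-- The pin sequence `w⋆ = φ(b⋆)`. -/
def wStar : ℕ → PinLetter := phiSeq bStar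

end Pin

namespace Pin

/-! The zeros of `bStar` spread out: a zero `z` and a later zero `z'` satisfy `z < (z' - z) ^ 2`
(`lt_sq_of_bStar_eq_false`). So far out a bounded window meets at most one zero, while isolated
zeros inside long blocks of ones occur for ever. Hence the recurrent factors of `wStar` are exactly
the factors of the words φ(1^k 0 1^l), and the factor joining two given zeros cannot recur. For the
inclusion of the box-interior, the permutations that embed in every tail of a pin sequence form a
box-closed class (`tailClass`) that lies between it and the pin class.

For the growth rate, all pins lie above the horizontal axis. Listed by height, a set of pins is
determined as a gridded permutation by the sides of its points and its inversions (same side, lower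
point farther out). Inversions occur only between pins of consecutive indices, at most three places
apart, so a word of four-bit letters (`code`) records everything, and the members of the class are
counted by codes (`ncard_pinClass`). A missing pin cuts a code into a concatenation; apart from
pairs starting at an odd index, runs of consecutive pins are indecomposable, and their codes form a
prefix code (`eq_of_items_append_eq`).

There are `itemCount k` codes of indecomposable runs of `k` pins touching at most one zero.
Arbitrary concatenations of these can be realized far out, which gives the lower recursion
`sum_mul_ncard_farCodes_le`. From the `N`-th pin on, the only other runs touch two zeros; they have
length at least √N and there are at most `k ^ 2 + 1` codes for each length `k`, so they contribute
arbitrarily little to the generating function (`ncard_tailCodes_le`, `exists_sum_le_one`). The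
finitely many pins before `N` cost a constant factor, apart from a sum over the length of the tail
(`ncard_classCodes_le`). Thus the growth rate is the `r` at which the generating function of
`itemCount` at `r⁻¹` equals 1, that is, the zero of `growthPoly` above 3. -/

/-! ### Gridded permutations of point sets, and containment. -/

/-- `P` holds on an initial segment, whose length is the cardinality. This turns the counts `vert`
and `horiz` of `ofPoints` into sign conditions. -/
theorem lt_card_filter_iff {n : ℕ} (P : Fin n → Prop) [DecidablePred P]
    (hP : ∀ i j, i ≤ j → P j → P i) (i : Fin n) :
    (i : ℕ) < (Finset.univ.filter P).card ↔ P i := by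
  constructor
  · intro h
    by_contra hi
    have hsub : Finset.univ.filter P ⊆ Finset.Iio i := by
      intro j hj
      rw [Finset.mem_filter] at hj
      rw [Finset.mem_Iio]
      by_contra hij
      exact hi (hP i j (not_lt.mp hij) hj.2)
    have := Finset.card_le_card hsub
    rw [Fin.card_Iio] at this
    omega
  · intro h
    have hsub : Finset.Iic i ⊆ Finset.univ.filter P := by
      intro j hj
      rw [Finset.mem_filter]
      exact ⟨Finset.mem_univ _, hP j i (Finset.mem_Iic.mp hj) h⟩
    have := Finset.card_le_card hsub
    rw [Fin.card_Iic] at this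
    omega

theorem strictMono_comp_sort {n : ℕ} {x : Fin n → ℤ} (hx : Function.Injective x) :
    StrictMono (x ∘ Tuple.sort x) :=
  (Tuple.monotone_sort x).strictMono_of_injective (hx.comp (Tuple.sort x).injective)

theorem card_filter_comp_equiv {n : ℕ} (e : Equiv.Perm (Fin n)) (P : Fin n → Prop)
    [DecidablePred P] :
    (Finset.univ.filter P).card = (Finset.univ.filter fun i => P (e i)).card := by
  symm
  refine Finset.card_bij (fun i _ => e i) ?_ ?_ ?_
  · intro i hi; simpa using hi
  · intro i _ j _ h; exact e.injective h
  · intro j hj; exact ⟨e.symm j, by simpa using hj, by simp⟩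

/-- `ofPoints p` is order isomorphic to `p` by a map that preserves cells. -/
theorem exists_equiv_ofPoints {n : ℕ} (p : Fin n → ℤ × ℤ)
    (hx : Function.Injective fun i => (p i).1) (hy : Function.Injective fun i => (p i).2) :
    ∃ e : Fin n ≃ Fin n,
      (∀ i j : Fin n, i < j ↔ (p (e i)).1 < (p (e j)).1) ∧
      (∀ i j : Fin n, (ofPoints p).perm i < (ofPoints p).perm j ↔ (p (e i)).2 < (p (e j)).2) ∧
      (∀ i : Fin n, (i : ℕ) < ((ofPoints p).vert : ℕ) ↔ (p (e i)).1 < 0) ∧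
      (∀ i : Fin n, ((ofPoints p).perm i : ℕ) < ((ofPoints p).horiz : ℕ) ↔ (p (e i)).2 < 0) := by
  have mx := strictMono_comp_sort hx
  have my := strictMono_comp_sort hy
  have hval : ∀ i : Fin n, (p (Tuple.sort (fun i => (p i).1) i)).2 =
      ((fun i => (p i).2) ∘ Tuple.sort (fun i => (p i).2)) ((ofPoints p).perm i) := by
    intro i
    change _ = (p (Tuple.sort (fun i => (p i).2) ((Tuple.sort (fun i => (p i).2)).symm
      (Tuple.sort (fun i => (p i).1) i)))).2
    rw [Equiv.apply_symm_apply]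
  refine ⟨Tuple.sort fun i => (p i).1, ?_, ?_, ?_, ?_⟩
  · intro i j
    exact (mx.lt_iff_lt (a := i) (b := j)).symm
  · intro i j
    rw [hval, hval]
    exact (my.lt_iff_lt).symm
  · intro i
    have h1 : ((ofPoints p).vert : ℕ) = (Finset.univ.filter fun i : Fin n => (p i).1 < 0).card := rfl
    rw [h1, card_filter_comp_equiv (Tuple.sort fun i => (p i).1)]
    refine lt_card_filter_iff _ ?_ i
    intro a b hab hb
    exact lt_of_le_of_lt (mx.monotone hab) hb
  · intro i
    have h1 : ((ofPoints p).horiz : ℕ) = (Finset.univ.filter fun i : Fin n => (p i).2 < 0).card := rfl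
    rw [h1, card_filter_comp_equiv (Tuple.sort fun i => (p i).2), hval]
    refine lt_card_filter_iff (fun i => (p (Tuple.sort (fun i => (p i).2) i)).2 < 0) ?_ _
    intro a b hab hb
    exact lt_of_le_of_lt (my.monotone hab) hb

theorem ofPoints_embedsIn {n : ℕ} {ι : Type*} {p : Fin n → ℤ × ℤ} {q : ι → ℤ × ℤ}
    (hx : Function.Injective fun i => (p i).1) (hy : Function.Injective fun i => (p i).2)
    (g : Fin n → ι)
    (h1 : ∀ i j, (p i).1 < (p j).1 ↔ (q (g i)).1 < (q (g j)).1)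
    (h2 : ∀ i j, (p i).2 < (p j).2 ↔ (q (g i)).2 < (q (g j)).2)
    (h3 : ∀ i, (p i).1 < 0 ↔ (q (g i)).1 < 0)
    (h4 : ∀ i, (p i).2 < 0 ↔ (q (g i)).2 < 0) : (ofPoints p).EmbedsIn q := by
  obtain ⟨e, e1, e2, e3, e4⟩ := exists_equiv_ofPoints p hx hy
  exact ⟨fun i => g (e i), fun i j => (e1 i j).trans (h1 _ _), fun i j => (e2 i j).trans (h2 _ _),
    fun i => (e3 i).trans (h3 _), fun i => (e4 i).trans (h4 _)⟩

theorem plot_fst_lt_iff (σ : GridPerm) (i j : Fin σ.len) :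
    (σ.plot i).1 < (σ.plot j).1 ↔ i < j := by
  simp only [GridPerm.plot, Fin.lt_def]; omega

theorem plot_snd_lt_iff (σ : GridPerm) (i j : Fin σ.len) :
    (σ.plot i).2 < (σ.plot j).2 ↔ σ.perm i < σ.perm j := by
  simp only [GridPerm.plot, Fin.lt_def]; omega

theorem plot_fst_neg_iff (σ : GridPerm) (i : Fin σ.len) :
    (σ.plot i).1 < 0 ↔ (i : ℕ) < (σ.vert : ℕ) := by
  simp only [GridPerm.plot]; omega

theorem plot_snd_neg_iff (σ : GridPerm) (i : Fin σ.len) :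
    (σ.plot i).2 < 0 ↔ (σ.perm i : ℕ) < (σ.horiz : ℕ) := by
  simp only [GridPerm.plot]; omega

theorem le_refl' (σ : GridPerm) : σ ≤ σ :=
  ⟨id, fun i j => (plot_fst_lt_iff σ i j).symm, fun i j => (plot_snd_lt_iff σ i j).symm,
    fun i => (plot_fst_neg_iff σ i).symm, fun i => (plot_snd_neg_iff σ i).symm⟩

theorem EmbedsIn.of_le {ι : Type*} {σ τ : GridPerm} {p : ι → ℤ × ℤ} (h : τ ≤ σ)
    (hσ : σ.EmbedsIn p) : τ.EmbedsIn p := by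
  obtain ⟨f, f1, f2, f3, f4⟩ := h
  obtain ⟨g, g1, g2, g3, g4⟩ := hσ
  refine ⟨fun i => g (f i), fun i j => ?_, fun i j => ?_, fun i => ?_, fun i => ?_⟩
  · rw [f1, plot_fst_lt_iff, g1]
  · rw [f2, plot_snd_lt_iff, g2]
  · rw [f3, plot_fst_neg_iff, g3]
  · rw [f4, plot_snd_neg_iff, g4]

/-! ### Box sums. -/

theorem pushOut_lt_iff {d x y : ℤ} (hd : 0 ≤ d) : pushOut d x < pushOut d y ↔ x < y := by
  unfold pushOut; split_ifs <;> omega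

theorem pushOut_neg_iff {d x : ℤ} (hd : 0 ≤ d) : pushOut d x < 0 ↔ x < 0 := by
  unfold pushOut; split_ifs <;> omega

theorem abs_plot_lt (σ : GridPerm) (i : Fin σ.len) :
    |(σ.plot i).1| < 2 * σ.len ∧ |(σ.plot i).2| < 2 * σ.len := by
  have h1 := i.2
  have h2 := (σ.perm i).2
  have h3 := σ.vert.2
  have h4 := σ.horiz.2
  simp only [GridPerm.plot, abs_lt]
  omega

/-- When one number is farther from 0 than another, their order depends only on the sign of the
farther one. -/
theorem lt_iff_of_abs_lt {x y x' y' : ℤ} (h : |x| < |y|) (h' : |x'| < |y'|) (hs : y < 0 ↔ y' < 0) :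
    (x < y ↔ x' < y') ∧ (y < x ↔ y' < x') := by
  rcases abs_cases x with ⟨a, a'⟩ | ⟨a, a'⟩ <;> rcases abs_cases y with ⟨b, b'⟩ | ⟨b, b'⟩ <;>
  rcases abs_cases x' with ⟨c, c'⟩ | ⟨c, c'⟩ <;> rcases abs_cases y' with ⟨d, d'⟩ | ⟨d, d'⟩ <;>
  omega

theorem abs_pushOut {d x : ℤ} (hd : 0 ≤ d) : |pushOut d x| = |x| + d := by
  unfold pushOut
  split_ifs with h
  · rw [abs_of_neg h, abs_of_neg (by omega)]; omega
  · rw [abs_of_nonneg (by omega), abs_of_nonneg (by omega)]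

/-- Two embeddings combine to one of the box sum as soon as the image of `τ` lies farther from both
axes than that of `σ`: comparisons across the two images are then decided by signs. -/
theorem boxSum_embedsIn {ι : Type*} {σ τ : GridPerm} {p : ι → ℤ × ℤ}
    (f : Fin σ.len → ι) (g : Fin τ.len → ι)
    (f1 : ∀ i j : Fin σ.len, i < j ↔ (p (f i)).1 < (p (f j)).1)
    (f2 : ∀ i j : Fin σ.len, σ.perm i < σ.perm j ↔ (p (f i)).2 < (p (f j)).2)
    (f3 : ∀ i : Fin σ.len, (i : ℕ) < (σ.vert : ℕ) ↔ (p (f i)).1 < 0)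
    (f4 : ∀ i : Fin σ.len, (σ.perm i : ℕ) < (σ.horiz : ℕ) ↔ (p (f i)).2 < 0)
    (g1 : ∀ i j : Fin τ.len, i < j ↔ (p (g i)).1 < (p (g j)).1)
    (g2 : ∀ i j : Fin τ.len, τ.perm i < τ.perm j ↔ (p (g i)).2 < (p (g j)).2)
    (g3 : ∀ i : Fin τ.len, (i : ℕ) < (τ.vert : ℕ) ↔ (p (g i)).1 < 0)
    (g4 : ∀ i : Fin τ.len, (τ.perm i : ℕ) < (τ.horiz : ℕ) ↔ (p (g i)).2 < 0)
    (hfg : ∀ i j, |(p (f i)).1| < |(p (g j)).1| ∧ |(p (f i)).2| < |(p (g j)).2|) :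
    (boxSum σ τ).EmbedsIn p := by
  have hd : (0 : ℤ) ≤ 2 * σ.len := by positivity
  have key1 : ∀ i j, (|(σ.plot i).1| < |pushOut (2 * σ.len) (τ.plot j).1|) ∧
      |(σ.plot i).2| < |pushOut (2 * σ.len) (τ.plot j).2| := by
    intro i j
    rw [abs_pushOut hd, abs_pushOut hd]
    have := abs_plot_lt σ i
    have h1 := abs_nonneg (τ.plot j).1
    have h2 := abs_nonneg (τ.plot j).2
    omega
  have s1 : ∀ j, pushOut (2 * σ.len) (τ.plot j).1 < 0 ↔ (p (g j)).1 < 0 := fun j => by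
    rw [pushOut_neg_iff hd, plot_fst_neg_iff, g3]
  have s2 : ∀ j, pushOut (2 * σ.len) (τ.plot j).2 < 0 ↔ (p (g j)).2 < 0 := fun j => by
    rw [pushOut_neg_iff hd, plot_snd_neg_iff, g4]
  set P : Fin (σ.len + τ.len) → ℤ × ℤ := Fin.append σ.plot fun j =>
    (pushOut (2 * σ.len) (τ.plot j).1, pushOut (2 * σ.len) (τ.plot j).2) with hP
  have h1 : ∀ i j, (P i).1 < (P j).1 ↔
      (p (Fin.append f g i)).1 < (p (Fin.append f g j)).1 := by
    intro i j
    refine Fin.addCases (fun i => ?_) (fun i => ?_) i <;>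
    refine Fin.addCases (fun j => ?_) (fun j => ?_) j <;>
    simp only [hP, Fin.append_left, Fin.append_right]
    · rw [plot_fst_lt_iff, f1]
    · exact (lt_iff_of_abs_lt (key1 i j).1 (hfg i j).1 (s1 j)).1
    · exact (lt_iff_of_abs_lt (key1 j i).1 (hfg j i).1 (s1 i)).2
    · rw [pushOut_lt_iff hd, plot_fst_lt_iff, g1]
  have h2 : ∀ i j, (P i).2 < (P j).2 ↔
      (p (Fin.append f g i)).2 < (p (Fin.append f g j)).2 := by
    intro i j
    refine Fin.addCases (fun i => ?_) (fun i => ?_) i <;>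
    refine Fin.addCases (fun j => ?_) (fun j => ?_) j <;>
    simp only [hP, Fin.append_left, Fin.append_right]
    · rw [plot_snd_lt_iff, f2]
    · exact (lt_iff_of_abs_lt (key1 i j).2 (hfg i j).2 (s2 j)).1
    · exact (lt_iff_of_abs_lt (key1 j i).2 (hfg j i).2 (s2 i)).2
    · rw [pushOut_lt_iff hd, plot_snd_lt_iff, g2]
  have trich : ∀ {m : ℕ} (e : Fin m → ℤ), (∀ i j, i ≠ j → e i < e j ∨ e j < e i) →
      Function.Injective e := by
    intro m e he i j hij
    by_contra hne
    rcases he i j hne with h | h <;> omega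
  have hfst : ∀ (ρ : GridPerm) (i j : Fin ρ.len), i ≠ j → 
      (ρ.plot i).1 < (ρ.plot j).1 ∨ (ρ.plot j).1 < (ρ.plot i).1 := by
    intro ρ i j hij
    rw [plot_fst_lt_iff, plot_fst_lt_iff]
    exact lt_or_gt_of_ne hij
  have hsnd : ∀ (ρ : GridPerm) (i j : Fin ρ.len), i ≠ j → 
      (ρ.plot i).2 < (ρ.plot j).2 ∨ (ρ.plot j).2 < (ρ.plot i).2 := by
    intro ρ i j hij
    rw [plot_snd_lt_iff, plot_snd_lt_iff]
    exact lt_or_gt_of_ne fun h => hij (ρ.perm.injective h)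
  have ne_of_abs : ∀ {x y : ℤ}, |x| < |y| → x < y ∨ y < x := by
    intro x y h
    apply lt_or_gt_of_ne
    rintro rfl
    exact lt_irrefl _ h
  have hneq : ∀ i j, i ≠ j → ((P i).1 < (P j).1 ∨ (P j).1 < (P i).1) ∧
      ((P i).2 < (P j).2 ∨ (P j).2 < (P i).2) := by
    intro i j
    refine Fin.addCases (fun i => ?_) (fun i => ?_) i <;>
    refine Fin.addCases (fun j => ?_) (fun j => ?_) j <;>
    simp only [hP, Fin.append_left, Fin.append_right]
    · intro h
      have h' : i ≠ j := fun e => h (by rw [e])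
      exact ⟨hfst σ i j h', hsnd σ i j h'⟩
    · intro _
      exact ⟨ne_of_abs (key1 i j).1, ne_of_abs (key1 i j).2⟩
    · intro _
      exact ⟨(ne_of_abs (key1 j i).1).symm, (ne_of_abs (key1 j i).2).symm⟩
    · intro h
      have h' : i ≠ j := fun e => h (by rw [e])
      simp only [pushOut_lt_iff hd]
      exact ⟨hfst τ i j h', hsnd τ i j h'⟩
  refine ofPoints_embedsIn (trich _ fun i j h => (hneq i j h).1)
    (trich _ fun i j h => (hneq i j h).2) (Fin.append f g) h1 h2 ?_ ?_
  · intro i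
    refine Fin.addCases (fun i => ?_) (fun i => ?_) i <;>
    simp only [Fin.append_left, Fin.append_right]
    · rw [plot_fst_neg_iff, f3]
    · exact s1 i
  · intro i
    refine Fin.addCases (fun i => ?_) (fun i => ?_) i <;>
    simp only [Fin.append_left, Fin.append_right]
    · rw [plot_snd_neg_iff, f4]
    · exact s2 i

/-! ### Letters of the pin sequence of a binary word. -/

theorem phiSeq_two_mul_add (b : ℕ → Bool) (m n : ℕ) :
    phiSeq b (2 * m + n) = phiSeq (fun x => b (m + x)) n := by
  have h1 : (2 * m + n) / 2 = m + n / 2 := by omega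
  have h2 : (2 * m + n) % 2 = n % 2 := by omega
  simp only [phiSeq, h1, h2]

theorem phiSeq_congr {b b' : ℕ → Bool} {n : ℕ} (h : b (n / 2) = b' (n / 2)) :
    phiSeq b n = phiSeq b' n := by
  simp only [phiSeq, h]

theorem phiSeq_of_even (b : ℕ → Bool) {n : ℕ} (h : n % 2 = 0) :
    phiSeq b n = if b (n / 2) then .ru else .lu := by
  have hx : ∀ x : Bool, (phiLetter x)[n % 2]'(mod_two_lt_length_phiLetter x n) =
      if x then .ru else .lu := by
    simp only [h]
    intro x
    cases x <;> rfl
  exact hx _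

theorem phiSeq_of_odd (b : ℕ → Bool) {n : ℕ} (h : n % 2 = 1) :
    phiSeq b n = if b (n / 2) then .ur else .ul := by
  have hx : ∀ x : Bool, (phiLetter x)[n % 2]'(mod_two_lt_length_phiLetter x n) =
      if x then .ur else .ul := by
    simp only [h]
    intro x
    cases x <;> rfl
  exact hx _

theorem phiSeq_eq_lu_iff (b : ℕ → Bool) (n : ℕ) :
    phiSeq b n = .lu ↔ n % 2 = 0 ∧ b (n / 2) = false := by
  rcases Nat.mod_two_eq_zero_or_one n with h | h
  · rw [phiSeq_of_even b h]
    cases b (n / 2) <;> simp [h]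
  · rw [phiSeq_of_odd b h]
    cases b (n / 2) <;> simp [h]

theorem isPinSequence_phiSeq (b : ℕ → Bool) : IsPinSequence (phiSeq b) := by
  intro i
  rcases Nat.mod_two_eq_zero_or_one i with h | h
  · have h1 : (i + 1) / 2 = i / 2 := by omega
    rw [phiSeq_of_even b h, phiSeq_of_odd b (n := i + 1) (by omega), h1]
    cases b (i / 2) <;> rfl
  · rw [phiSeq_of_odd b h, phiSeq_of_even b (n := i + 1) (by omega)]
    cases b (i / 2) <;> cases b ((i + 1) / 2) <;> rfl

/-! ### The zeros of `bStar` -/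

theorem two_mul_length_bApprox (m : ℕ) : 2 * (bApprox m).length = m * (m + 3) := by
  induction m with
  | zero => rfl
  | succ m ih =>
    simp only [bApprox, List.length_append, List.length_replicate, List.length_singleton]
    linarith

/-- Each `bApprox i` with `i ≥ 1` has length `i * (i + 3) / 2` and ends with its new zero, so the
zeros are the last positions of these prefixes. -/
theorem bApprox_eq_false_iff (m n : ℕ) (h : n < (bApprox m).length) :
    (bApprox m)[n] = false ↔ ∃ i, 1 ≤ i ∧ i ≤ m ∧ 2 * (n + 1) = i * (i + 3) := by
  induction m with
  | zero => simp [bApprox] at h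
  | succ m ih =>
    have hl := two_mul_length_bApprox m
    have hl' := two_mul_length_bApprox (m + 1)
    by_cases h1 : n < (bApprox m).length
    · have : (bApprox (m + 1))[n] = (bApprox m)[n] := by
        simp only [bApprox, List.append_assoc]
        rw [List.getElem_append_left h1]
      rw [this, ih h1]
      constructor
      · rintro ⟨i, a, b, c⟩
        exact ⟨i, a, by omega, c⟩
      · rintro ⟨i, a, b, c⟩
        refine ⟨i, a, ?_, c⟩
        by_contra hi
        have : i = m + 1 := by omega
        subst this
        nlinarith
    · have e : (bApprox (m + 1))[n] =
          (List.replicate (m + 1) true ++ [false])[n - (bApprox m).length]'(by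
            simp only [bApprox, List.length_append, List.length_replicate,
              List.length_singleton] at h ⊢; omega) := by
        simp only [bApprox, List.append_assoc]
        rw [List.getElem_append_right (by omega)]
      rw [e]
      by_cases h2 : n - (bApprox m).length < m + 1
      · rw [List.getElem_append_left (by simpa using h2)]
        simp only [List.getElem_replicate, Bool.true_eq_false, false_iff]
        rintro ⟨i, a, b, c⟩
        rcases Nat.lt_or_ge i (m + 1) with hi | hi
        · have : i * (i + 3) ≤ m * (m + 3) := Nat.mul_le_mul (by omega) (by omega)
          omega
        · have : i = m + 1 := by omega
          subst this
          have : n < (bApprox m).length + (m + 1) := by omega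
          nlinarith
      · have hn : n = (bApprox m).length + (m + 1) := by
          simp only [bApprox, List.length_append, List.length_replicate,
            List.length_singleton] at h
          omega
        rw [List.getElem_append_right (by rw [List.length_replicate]; omega)]
        simp only [List.getElem_singleton, true_iff]
        exact ⟨m + 1, by omega, le_rfl, by rw [hn]; nlinarith⟩

theorem bStar_eq_false_iff (n : ℕ) :
    bStar n = false ↔ ∃ i, 1 ≤ i ∧ 2 * (n + 1) = i * (i + 3) := by
  unfold bStar
  rw [bApprox_eq_false_iff]
  constructor
  · rintro ⟨i, a, _, c⟩
    exact ⟨i, a, c⟩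
  · rintro ⟨i, a, c⟩
    exact ⟨i, a, by nlinarith, c⟩

/-- The zero ending `bApprox i` is followed by the next one at distance `i + 2`, while `z + 1 = i *
(i + 3) / 2 < (i + 2) ^ 2`. -/
theorem lt_sq_of_bStar_eq_false {z z' : ℕ} (h : bStar z = false) (h' : bStar z' = false)
    (hz : z < z') : z < (z' - z) ^ 2 := by
  obtain ⟨i, hi, hi'⟩ := (bStar_eq_false_iff z).mp h
  obtain ⟨j, hj, hj'⟩ := (bStar_eq_false_iff z').mp h'
  obtain ⟨d, rfl⟩ := Nat.exists_eq_add_of_lt hz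
  have hij : i < j := by
    by_contra hc
    have : j * (j + 3) ≤ i * (i + 3) := Nat.mul_le_mul (by omega) (by omega)
    omega
  have h1 : (i + 1) * (i + 1 + 3) ≤ j * (j + 3) := Nat.mul_le_mul (by omega) (by omega)
  have h2 : z + d + 1 - z = d + 1 := by omega
  rw [h2]
  have h3 : i + 2 ≤ d + 1 := by nlinarith
  nlinarith

theorem exists_bStar_eq_false_ge (N : ℕ) : ∃ z, N ≤ z ∧ bStar z = false := by
  have h : ∃ q, (N + 1) * (N + 4) = 2 * (q + 1) := by
    have he : Even ((N + 1) * (N + 4)) := by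
      rcases Nat.even_or_odd N with h | h
      · exact (h.add (by decide : Even 4)).mul_left _
      · exact (h.add_odd (by decide : Odd 1)).mul_right _
    obtain ⟨r, hr⟩ := he
    have : r ≠ 0 := by
      rintro rfl
      nlinarith
    exact ⟨r - 1, by omega⟩
  obtain ⟨q, hq⟩ := h
  exact ⟨q, by nlinarith, (bStar_eq_false_iff q).mpr ⟨N + 1, by omega, by linarith⟩⟩

/-- Arbitrarily far to the right there are isolated zeros with long blocks of ones around. -/
theorem exists_isolated_zero (N K : ℕ) : ∃ z, N + K ≤ z ∧
    ∀ n, z ≤ n + K → n ≤ z + K → bStar n = decide (n ≠ z) := by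
  -- Even the left end of the window of radius `K` around `z` is then at least `K ^ 2`, so a second
  -- zero in it would violate the gap bound.
  obtain ⟨z, hz, h0⟩ := exists_bStar_eq_false_ge (N + K + K ^ 2)
  refine ⟨z, by omega, fun n h1 h2 => ?_⟩
  by_cases hn : n = z
  · simpa [hn] using h0
  · simp only [ne_eq, hn, not_false_eq_true, decide_true]
    by_contra hb
    rw [Bool.not_eq_true] at hb
    rcases Nat.lt_or_ge n z with h | h
    · have := lt_sq_of_bStar_eq_false hb h0 h
      have : (z - n) ^ 2 ≤ K ^ 2 := Nat.pow_le_pow_left (by omega) 2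
      omega
    · have := lt_sq_of_bStar_eq_false h0 hb (by omega)
      have : (n - z) ^ 2 ≤ K ^ 2 := Nat.pow_le_pow_left (by omega) 2
      omega

/-! ### Failure of recurrence. -/

/-- A factor running from one zero to another fixes a distance between zeros. If it recurred, zeros
at that distance would occur arbitrarily far out, against the gap bound. -/
theorem not_eventuallyRecurrent_wStar : ¬ EventuallyRecurrent wStar := by
  rintro ⟨N, hN⟩
  obtain ⟨z, hz, hz0⟩ := exists_bStar_eq_false_ge N
  obtain ⟨z', hz', hz0'⟩ := exists_bStar_eq_false_ge (z + 1)
  have hf := hN (List.ofFn fun t : Fin (2 * (z' - z) + 1) => wStar (2 * z + t))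
    ⟨2 * z - N, fun j hj => by
      rw [List.getElem_ofFn]
      change wStar (N + (2 * z - N + j)) = wStar (2 * z + j)
      congr 1
      omega⟩
  -- Two pins per binary letter: the first zero of this occurrence is at a binary position at least
  -- `(z' - z) ^ 2`.
  obtain ⟨i, hi, hlt⟩ := hf.exists_gt (2 * (z' - z) ^ 2)
  have e1 := hi 0 (by simp)
  have e2 := hi (2 * (z' - z)) (by simp)
  rw [List.getElem_ofFn] at e1 e2
  have v1 : wStar (2 * z + 0) = .lu := by
    unfold wStar
    rw [phiSeq_eq_lu_iff]
    refine ⟨by omega, ?_⟩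
    rw [← hz0]; congr 1; omega
  have v2 : wStar (2 * z + 2 * (z' - z)) = .lu := by
    unfold wStar
    rw [phiSeq_eq_lu_iff]
    refine ⟨by omega, ?_⟩
    rw [← hz0']; congr 1; omega
  have w1 := e1.trans v1
  have w2 := e2.trans v2
  unfold wStar at w1 w2
  rw [phiSeq_eq_lu_iff] at w1 w2
  have h3 : (N + (i + 2 * (z' - z))) / 2 = (N + (i + 0)) / 2 + (z' - z) := by omega
  rw [h3] at w2
  have := lt_sq_of_bStar_eq_false w1.2 w2.2 (by omega)
  rw [Nat.add_sub_cancel_left] at this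
  omega

theorem not_recurrent_wStar : ¬ Recurrent wStar := fun h =>
  not_eventuallyRecurrent_wStar ⟨0, by simpa using h⟩

/-! ### Recurrent factors -/

theorem OccursAt.congr {α : Type*} {f : List α} {w w' : ℕ → α} {i i' : ℕ} (h : OccursAt f w i)
    (hw : ∀ j < f.length, w (i + j) = w' (i' + j)) : OccursAt f w' i' :=
  fun j hj => (hw j hj).symm.trans (h j hj)

/-- The infinite word all of whose letters are `1`, except for one `0` at position `z`. -/
def zeroAt (z : ℕ) (n : ℕ) : Bool := decide (n ≠ z)

theorem length_phi (L : List Bool) : (phi L).length = 2 * L.length := by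
  induction L with
  | nil => rfl
  | cons x L ih =>
    have : (phiLetter x).length = 2 := by cases x <;> rfl
    simp only [phi, List.flatMap_cons, List.length_append, List.length_cons] at ih ⊢
    omega

/-- The default `true` is chosen so that 1^k 0 1^l extends to the infinite word `zeroAt k`, which
does not depend on `l`. -/
theorem getElem_phi (L : List Bool) (n : ℕ) (h : n < (phi L).length) :
    (phi L)[n] = phiSeq (fun i => L.getD i true) n := by
  induction L generalizing n with
  | nil => simp [phi] at h
  | cons x L ih =>
    have hl : (phiLetter x).length = 2 := by cases x <;> rfl
    have hc : phi (x :: L) = phiLetter x ++ phi L := rfl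
    simp only [hc] at h ⊢
    by_cases hn : n < 2
    · rw [List.getElem_append_left (by omega)]
      have h1 : n / 2 = 0 := by omega
      have h2 : n % 2 = n := by omega
      simp only [phiSeq, h1, h2, List.getD_cons_zero]
    · rw [List.getElem_append_right (by omega), ih]
      have h1 : (fun i => L.getD i true) = fun i => (x :: L).getD (1 + i) true := by
        funext i
        rw [add_comm, List.getD_cons_succ]
      rw [h1, ← phiSeq_two_mul_add (fun i => (x :: L).getD i true) 1]
      congr 1
      omega

theorem infix_phi_iff (f : List PinLetter) (L : List Bool) :
    f <:+: phi L ↔ ∃ i, i + f.length ≤ 2 * L.length ∧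
      OccursAt f (phiSeq fun i => L.getD i true) i := by
  constructor
  · rintro ⟨s, t, h⟩
    have hlen := congrArg List.length h
    rw [length_phi, List.length_append, List.length_append] at hlen
    refine ⟨s.length, by omega, fun j hj => ?_⟩
    rw [← getElem_phi L _ (by rw [length_phi]; omega)]
    simp only [← h]
    rw [List.getElem_append_left (by rw [List.length_append]; omega),
      List.getElem_append_right (by omega)]
    simp
  · rintro ⟨i, hi, h⟩
    have : f = ((phi L).drop i).take f.length := by
      apply List.ext_getElem
      · rw [List.length_take, List.length_drop, length_phi]; omega
      · intro j h1 h2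
        rw [List.getElem_take, List.getElem_drop, getElem_phi, h j h1]
    rw [this]
    exact (List.take_prefix _ _).isInfix.trans (List.drop_suffix _ _).isInfix

theorem getD_eq_zeroAt (k l n : ℕ) :
    (List.replicate k true ++ [false] ++ List.replicate l true).getD n true = zeroAt k n := by
  unfold zeroAt
  rw [List.append_assoc]
  rcases lt_trichotomy n k with h | h | h
  · rw [List.getD_append _ _ _ _ (by simpa using h), List.getD_eq_getElem _ _ (by simpa using h)]
    simp; omega
  · rw [List.getD_append_right _ _ _ _ (by simp [h])]
    simp [h]
  · rw [List.getD_append_right _ _ _ _ (by simp; omega), List.length_replicate]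
    obtain ⟨d, rfl⟩ := Nat.exists_eq_add_of_lt h
    have : k + d + 1 - k = d + 1 := by omega
    rw [this]
    simp [List.getElem?_replicate]
    split_ifs <;> simp <;> omega

theorem infix_phi_replicate_iff (f : List PinLetter) (k l : ℕ) :
    f <:+: phi (List.replicate k true ++ [false] ++ List.replicate l true) ↔
      ∃ i, i + f.length ≤ 2 * (k + 1 + l) ∧ OccursAt f (phiSeq (zeroAt k)) i := by
  rw [infix_phi_iff]
  simp only [getD_eq_zeroAt, List.length_append, List.length_replicate, List.length_singleton]

theorem isRecurrentFactor_of_infix {f : List PinLetter} {k l : ℕ}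
    (h : f <:+: phi (List.replicate k true ++ [false] ++ List.replicate l true)) :
    IsRecurrentFactor f wStar := by
  obtain ⟨i, hi, ho⟩ := (infix_phi_replicate_iff f k l).mp h
  refine Set.infinite_of_forall_exists_gt fun N => ?_
  obtain ⟨z, hz, hz'⟩ := exists_isolated_zero (N + 1) (k + l + 1)
  -- The shift carries the zero at position `k` to the isolated zero `z`.
  refine ⟨2 * (z - k) + i, ho.congr fun j hj => ?_, by omega⟩
  rw [wStar, add_assoc, phiSeq_two_mul_add]
  apply phiSeq_congr
  rw [hz' _ (by omega) (by omega), zeroAt]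
  congr 1
  apply propext
  omega

/-- A recurrent factor has an occurrence so far out that its window contains at most one zero, by
the gap bound. -/
theorem exists_infix_of_isRecurrentFactor {f : List PinLetter} (h : IsRecurrentFactor f wStar) :
    ∃ k l, f <:+: phi (List.replicate k true ++ [false] ++ List.replicate l true) := by
  obtain ⟨i, ho, hi⟩ := h.exists_gt (2 * (f.length + 1) ^ 2 + 2)
  by_cases hz : ∃ z, i / 2 ≤ z ∧ z ≤ (i + f.length) / 2 ∧ bStar z = false
  · obtain ⟨z, h1, h2, h3⟩ := hz
    have hfz : f.length ≤ z := by
      have : (f.length + 1) ^ 2 ≤ i / 2 := by omega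
      nlinarith
    -- Blocks of `f.length` ones on both sides of the zero are long enough; the offset aligns `z`
    -- with position `f.length`.
    refine ⟨f.length, f.length, (infix_phi_replicate_iff _ _ _).mpr
      ⟨i + 2 * f.length - 2 * z, by omega, ho.congr fun j hj => ?_⟩⟩
    have e1 : i + j = 2 * (z - f.length) + (i + 2 * f.length - 2 * z + j) := by
      omega
    rw [wStar, e1, phiSeq_two_mul_add]
    apply phiSeq_congr
    rw [zeroAt]
    by_cases hn : (i + 2 * f.length - 2 * z + j) / 2 = f.length
    · simp only [hn, ne_eq, not_true_eq_false, decide_false]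
      rw [← h3]; congr 1; omega
    · simp only [hn, ne_eq, not_false_eq_true, decide_true]
      by_contra hb
      rw [Bool.not_eq_true] at hb
      set y := z - f.length + (i + 2 * f.length - 2 * z + j) / 2 with hy
      rcases lt_trichotomy y z with hyz | hyz | hyz
      · have := lt_sq_of_bStar_eq_false hb h3 hyz
        have : (z - y) ^ 2 ≤ (f.length + 1) ^ 2 := Nat.pow_le_pow_left (by omega) 2
        omega
      · omega
      · have := lt_sq_of_bStar_eq_false h3 hb hyz
        have : (y - z) ^ 2 ≤ (f.length + 1) ^ 2 := Nat.pow_le_pow_left (by omega) 2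
        omega
  · push Not at hz
    -- No zero is met: the factor fits into the ones before the zero, and only the parity of its
    -- start matters.
    refine ⟨f.length + 1, 0, (infix_phi_replicate_iff _ _ _).mpr
      ⟨i % 2, by omega, ho.congr fun j hj => ?_⟩⟩
    have e1 : i + j = 2 * (i / 2) + (i % 2 + j) := by omega
    rw [wStar, e1, phiSeq_two_mul_add]
    apply phiSeq_congr
    have := hz (i / 2 + (i % 2 + j) / 2) (by omega) (by omega)
    rw [Bool.ne_false_iff] at this
    rw [this, zeroAt]
    symm
    rw [decide_eq_true_iff]
    omega

/-! ### Tails of pin sequences and the box-interior. -/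

/-- Both distances of a pin from the axes grow by 2 with each index, so a factor read later gives
the same picture pushed outwards. -/
theorem pinPoint_add (N i : ℕ) (L : PinLetter) :
    pinPoint (N + i) L = (pushOut (2 * N) (pinPoint i L).1, pushOut (2 * N) (pinPoint i L).2) := by
  cases L <;> simp only [pinPoint, pushOut, Prod.mk.injEq] <;> constructor <;> push_cast <;>
    split_ifs <;> omega

theorem abs_pinPoint_bounds (i : ℕ) (L : PinLetter) :
    (2 * i + 1 ≤ |(pinPoint i L).1| ∧ |(pinPoint i L).1| ≤ 2 * i + 4) ∧
      2 * i + 1 ≤ |(pinPoint i L).2| ∧ |(pinPoint i L).2| ≤ 2 * i + 4 := by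
  cases L <;> simp only [pinPoint, abs_le, le_abs] <;> omega

theorem pinPoint_fst_inj {i j : ℕ} {L L' : PinLetter}
    (h : (pinPoint i L).1 = (pinPoint j L').1) : i = j := by
  cases L <;> cases L' <;> simp only [pinPoint] at h <;> omega

theorem pinPoint_snd_inj {i j : ℕ} {L L' : PinLetter}
    (h : (pinPoint i L).2 = (pinPoint j L').2) : i = j := by
  cases L <;> cases L' <;> simp only [pinPoint] at h <;> omega

theorem OccursAt.pinPerm_embedsIn {f : List PinLetter} {w : ℕ → PinLetter} {N i : ℕ}
    (h : OccursAt f w (N + i)) :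
    (pinPerm f).EmbedsIn fun n : ℕ => pinPoint (N + n) (w (N + n)) := by
  have key : ∀ j : Fin f.length, pinPoint (N + (i + j)) (w (N + (i + j))) =
      (pushOut (2 * (N + i : ℕ)) (pinPoint j (f.get j)).1,
        pushOut (2 * (N + i : ℕ)) (pinPoint j (f.get j)).2) := by
    intro j
    rw [← pinPoint_add, ← add_assoc, h j j.2, List.get_eq_getElem]
  have hd : (0 : ℤ) ≤ 2 * (N + i : ℕ) := by positivity
  refine ofPoints_embedsIn (fun a b hab => Fin.ext (pinPoint_fst_inj hab))
    (fun a b hab => Fin.ext (pinPoint_snd_inj hab)) (fun j => i + j) ?_ ?_ ?_ ?_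
  · intro a b; rw [key, key, pushOut_lt_iff hd]
  · intro a b; rw [key, key, pushOut_lt_iff hd]
  · intro a; rw [key, pushOut_neg_iff hd]
  · intro a; rw [key, pushOut_neg_iff hd]

theorem isGridClass_boxClosure (D : Set GridPerm) : IsGridClass (boxClosure D) :=
  fun σ hσ τ hτ C hC => hC.1 σ (hσ C hC) τ hτ

theorem boxClosed_boxClosure (D : Set GridPerm) : BoxClosed (boxClosure D) :=
  fun σ hσ τ hτ C hC => hC.2.1 σ (hσ C hC) τ (hτ C hC)

theorem subset_boxClosure (D : Set GridPerm) : D ⊆ boxClosure D :=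
  fun _ hσ _ hC => hC.2.2 hσ

theorem boxClosure_subset {C D : Set GridPerm} (h1 : IsGridClass C) (h2 : BoxClosed C)
    (h3 : D ⊆ C) : boxClosure D ⊆ C :=
  fun _ hσ => hσ C ⟨h1, h2, h3⟩

/-- The gridded permutations that are contained in all tails of a pin sequence. -/
def tailClass (w : ℕ → PinLetter) : Set GridPerm :=
  {σ | ∀ N : ℕ, σ.EmbedsIn fun n : ℕ => pinPoint (N + n) (w (N + n))}

theorem isGridClass_tailClass (w : ℕ → PinLetter) : IsGridClass (tailClass w) :=
  fun _ hσ _ hτ N => EmbedsIn.of_le hτ (hσ N)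

/-- An embedding of `σ` uses finitely many pins, and `τ` still embeds in the tail beyond them. -/
theorem boxClosed_tailClass (w : ℕ → PinLetter) : BoxClosed (tailClass w) := by
  intro σ hσ τ hτ N
  obtain ⟨f, f1, f2, f3, f4⟩ := hσ N
  obtain ⟨M, hM⟩ : ∃ M, ∀ i, f i ≤ M := ⟨Finset.univ.sup f, fun i => Finset.le_sup (by simp)⟩
  -- Pins up to `N + M` have coordinates at most `2 * (N + M) + 4` in absolute value, those from `N
  -- + M + 2` on at least `2 * (N + M) + 5`.
  obtain ⟨g, g1, g2, g3, g4⟩ := hτ (N + (M + 2))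
  have e : ∀ i, N + (M + 2) + g i = N + (M + 2 + g i) := fun i => add_assoc _ _ _
  simp only [e] at g1 g2 g3 g4
  refine boxSum_embedsIn f (fun i => M + 2 + g i) f1 f2 f3 f4 g1 g2 g3 g4 fun i j => ?_
  have := hM i
  have h1 := abs_pinPoint_bounds (N + f i) (w (N + f i))
  have h2 := abs_pinPoint_bounds (N + (M + 2 + g j)) (w (N + (M + 2 + g j)))
  push_cast at h1 h2
  constructor <;> omega

theorem tailClass_subset_pinClass (w : ℕ → PinLetter) : tailClass w ⊆ pinClass w := by
  intro σ hσ
  simpa [pinClass] using hσ 0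

theorem IsRecurrentFactor.pinPerm_mem_tailClass {f : List PinLetter} {w : ℕ → PinLetter}
    (h : IsRecurrentFactor f w) : pinPerm f ∈ tailClass w := by
  intro N
  obtain ⟨i, ho, hi⟩ := h.exists_gt N
  obtain ⟨d, rfl⟩ := Nat.exists_eq_add_of_lt hi
  rw [Set.mem_ofPred_eq, add_assoc] at ho
  exact ho.pinPerm_embedsIn

theorem boxInterior_subset_pinClass (w : ℕ → PinLetter) : boxInterior w ⊆ pinClass w := by
  refine (boxClosure_subset (isGridClass_tailClass w) (boxClosed_tailClass w) ?_).trans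
    (tailClass_subset_pinClass w)
  rintro σ ⟨_, u, hu, hσ⟩
  exact isGridClass_tailClass w _ hu.pinPerm_mem_tailClass _ hσ

theorem boxInterior_wStar :
    boxInterior wStar = boxClosure {σ | ∃ (k l : ℕ) (f : List PinLetter),
        f <:+: phi (List.replicate k true ++ [false] ++ List.replicate l true) ∧
        σ = pinPerm f} := by
  apply Set.Subset.antisymm
  · refine boxClosure_subset (isGridClass_boxClosure _) (boxClosed_boxClosure _) ?_
    rintro σ ⟨_, u, hu, hσ⟩
    obtain ⟨k, l, hf⟩ := exists_infix_of_isRecurrentFactor hu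
    refine isGridClass_boxClosure _ (pinPerm u) (subset_boxClosure _ ?_) _ hσ
    exact ⟨k, l, u, hf, rfl⟩
  · refine boxClosure_subset (isGridClass_boxClosure _) (boxClosed_boxClosure _) ?_
    rintro σ ⟨k, l, f, hf, rfl⟩
    have hr := isRecurrentFactor_of_infix hf
    exact subset_boxClosure _
      ⟨tailClass_subset_pinClass _ hr.pinPerm_mem_tailClass, f, hr, le_refl' _⟩

/-! ### Pins in the order of their heights -/

/-- The place in the bottom-to-top order of the `i`-th pin of a sequence `phiSeq b`; the place `1`
is not used. -/
def toPlace (i : ℕ) : ℕ := i + 2 * (i % 2)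

/-- The pin at a place of the bottom-to-top order. -/
def pinAt (q : ℕ) : ℕ := q - 2 * (q % 2)

/-- The side of the pin at a place: `true` means right. -/
def sideAt (b : ℕ → Bool) (q : ℕ) : Bool := b (pinAt q / 2)

theorem pinAt_toPlace (i : ℕ) : pinAt (toPlace i) = i := by
  unfold pinAt toPlace; omega

theorem toPlace_pinAt {q : ℕ} (h : q ≠ 1) : toPlace (pinAt q) = q := by
  unfold pinAt toPlace; omega

theorem toPlace_ne_one (i : ℕ) : toPlace i ≠ 1 := by
  unfold toPlace; omega

/-- The pins at the places `p < q` lie on the same side, and the lower one lies farther out. -/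
def Inv (s : ℕ → Bool) (p q : ℕ) : Prop := p % 2 = 0 ∧ (q = p + 1 ∨ q = p + 3) ∧ s p = s q

instance (s : ℕ → Bool) (p q : ℕ) : Decidable (Inv s p q) := by unfold Inv; infer_instance

/-- For places `p < q`, the pin at `p` lies to the left of that at `q`. -/
def LeftOf (s : ℕ → Bool) (p q : ℕ) : Prop :=
  (s p = false ∧ s q = true) ∨ (s p = s q ∧ (s p = true ↔ ¬ Inv s p q))

theorem pinPoint_snd (b : ℕ → Bool) (i : ℕ) :
    (pinPoint i (phiSeq b i)).2 = 2 * toPlace i + 1 - (toPlace i % 2 : ℕ) := by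
  unfold toPlace
  rcases Nat.mod_two_eq_zero_or_one i with h | h
  · rw [phiSeq_of_even b h]
    split_ifs <;> simp only [pinPoint] <;> omega
  · rw [phiSeq_of_odd b h]
    split_ifs <;> simp only [pinPoint] <;> omega

/-- An even place `p` holds the side pin of index `p`, at distance `2 * p + 4`; an odd place `q`
holds the up pin of index `q - 2`, at distance `2 * q - 3`. The 7 is the difference of the two
formulas. -/
theorem pinPoint_fst (b : ℕ → Bool) (i : ℕ) :
    (pinPoint i (phiSeq b i)).1 = if sideAt b (toPlace i) then
      (2 * toPlace i + 4 - 7 * (toPlace i % 2 : ℕ) : ℤ) else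
      -(2 * toPlace i + 4 - 7 * (toPlace i % 2 : ℕ) : ℤ) := by
  unfold sideAt
  rw [pinAt_toPlace]
  unfold toPlace
  rcases Nat.mod_two_eq_zero_or_one i with h | h
  · rw [phiSeq_of_even b h]
    split_ifs <;> simp only [pinPoint] <;> omega
  · rw [phiSeq_of_odd b h]
    split_ifs <;> simp only [pinPoint] <;> omega

theorem pinPoint_snd_lt_iff (b : ℕ → Bool) (i j : ℕ) :
    (pinPoint i (phiSeq b i)).2 < (pinPoint j (phiSeq b j)).2 ↔ toPlace i < toPlace j := by
  rw [pinPoint_snd, pinPoint_snd]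
  omega

theorem pinPoint_snd_pos (b : ℕ → Bool) (i : ℕ) : ¬ (pinPoint i (phiSeq b i)).2 < 0 := by
  rw [pinPoint_snd]
  omega

theorem pinPoint_fst_neg_iff (b : ℕ → Bool) (i : ℕ) :
    (pinPoint i (phiSeq b i)).1 < 0 ↔ sideAt b (toPlace i) = false := by
  have := toPlace_ne_one i
  rw [pinPoint_fst]
  cases sideAt b (toPlace i) <;> simp <;> omega

/-- On one side, a lower pin can be farther out only if `p` is even and `q` odd with `2 * q - 3 < 2
* p + 4`, whence `q = p + 1` or `q = p + 3`. These are the up pins just before and just after the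
side pin at `p`. -/
theorem pinPoint_fst_lt_iff (b : ℕ → Bool) {i j : ℕ} (h : toPlace i < toPlace j) :
    (pinPoint i (phiSeq b i)).1 < (pinPoint j (phiSeq b j)).1 ↔
      LeftOf (sideAt b) (toPlace i) (toPlace j) := by
  have h1 := toPlace_ne_one i
  have h2 := toPlace_ne_one j
  rw [pinPoint_fst, pinPoint_fst]
  unfold LeftOf Inv
  generalize toPlace i = p at *
  generalize toPlace j = q at *
  cases sideAt b p <;> cases sideAt b q <;> simp <;> omega

/-! ### Codes -/

/-- The letters of codes: the side of a point, followed by three bits that tell with which of the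
next three higher points it forms an inversion. -/
abbrev CodeLetter := Bool × Bool × Bool × Bool

/-- Is there an inversion between the points of index `t` and `t + d` in the list `l`? -/
def invBit (s : ℕ → Bool) (l : List ℕ) (t d : ℕ) : Bool :=
  decide (t + d < l.length ∧ Inv s (l.getD t 0) (l.getD (t + d) 0))

/-- The code of the pins at the places in `l`. -/
def code (s : ℕ → Bool) (l : List ℕ) : List CodeLetter :=
  (List.range l.length).map fun t =>
    (s (l.getD t 0), invBit s l t 1, invBit s l t 2, invBit s l t 3)

theorem length_code (s : ℕ → Bool) (l : List ℕ) : (code s l).length = l.length := by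
  simp [code]

theorem getElem_code (s : ℕ → Bool) (l : List ℕ) (t : ℕ) (h : t < (code s l).length) :
    (code s l)[t] = (s (l.getD t 0), invBit s l t 1, invBit s l t 2, invBit s l t 3) := by
  simp [code]

theorem code_congr {s s' : ℕ → Bool} {l l' : List ℕ} (hl : l.length = l'.length)
    (h1 : ∀ t < l.length, s (l.getD t 0) = s' (l'.getD t 0))
    (h2 : ∀ t t', t < t' → t' < l.length →
      (Inv s (l.getD t 0) (l.getD t' 0) ↔ Inv s' (l'.getD t 0) (l'.getD t' 0))) :
    code s l = code s' l' := by
  have hb : ∀ t d, 0 < d → invBit s l t d = invBit s' l' t d := by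
    intro t d hd
    unfold invBit
    congr 1
    apply propext
    rw [← hl]
    exact and_congr_right fun h => h2 _ _ (by omega) h
  apply List.ext_getElem
  · rw [length_code, length_code, hl]
  · intro t ht ht'
    rw [length_code] at ht
    rw [getElem_code, getElem_code, h1 t ht, hb t 1 (by omega), hb t 2 (by omega),
      hb t 3 (by omega)]

theorem getD_add_le {l : List ℕ} (hl : l.Pairwise (· < ·)) (t d : ℕ) (h : t + d < l.length) :
    l.getD t 0 + d ≤ l.getD (t + d) 0 := by
  induction d with
  | zero => simp
  | succ d ih =>
    have h1 := ih (by omega)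
    have h2 := (List.pairwise_iff_getElem.mp hl) (t + d) (t + (d + 1)) (by omega) h (by omega)
    rw [← List.getD_eq_getElem l 0, ← List.getD_eq_getElem l 0] at h2
    omega

theorem Inv.le {s : ℕ → Bool} {p q : ℕ} (h : Inv s p q) : q ≤ p + 3 := by
  unfold Inv at h; omega

theorem invBit_of_code_eq {s s' : ℕ → Bool} {l l' : List ℕ} {v : List CodeLetter}
    (h : code s l ++ v = code s' l') {t d : ℕ} (ht : t < l.length) (h1 : 1 ≤ d) (h3 : d ≤ 3) :
    invBit s l t d = invBit s' l' t d := by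
  have hlen := congrArg List.length h
  rw [List.length_append, length_code, length_code] at hlen
  have e : (code s l ++ v)[t]'(by rw [List.length_append, length_code]; omega) =
      (code s' l')[t]'(by rw [length_code]; omega) := by
    congr 1
  rw [List.getElem_append_left (by rw [length_code]; omega), getElem_code, getElem_code,
    Prod.mk.injEq, Prod.mk.injEq, Prod.mk.injEq] at e
  have : d = 1 ∨ d = 2 ∨ d = 3 := by omega
  rcases this with rfl | rfl | rfl
  exacts [e.2.1, e.2.2.1, e.2.2.2]

theorem side_of_code_eq {s s' : ℕ → Bool} {l l' : List ℕ} (h : code s l = code s' l') {t : ℕ}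
    (ht : t < l.length) : s (l.getD t 0) = s' (l'.getD t 0) := by
  have hlen := congrArg List.length h
  rw [length_code, length_code] at hlen
  have e : (code s l)[t]'(by rw [length_code]; omega) =
      (code s' l')[t]'(by rw [length_code]; omega) := by
    congr 1
  rw [getElem_code, getElem_code, Prod.mk.injEq] at e
  exact e.1

/-- An inversion spans at most three places, hence at most three indices of an increasing list, so
the three bits miss none. -/
theorem inv_iff_of_code_eq {s s' : ℕ → Bool} {l l' : List ℕ} (hl : l.Pairwise (· < ·))
    (hl' : l'.Pairwise (· < ·)) (h : code s l = code s' l') {t t' : ℕ} (htt : t < t')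
    (ht : t' < l.length) :
    Inv s (l.getD t 0) (l.getD t' 0) ↔ Inv s' (l'.getD t 0) (l'.getD t' 0) := by
  have hlen := congrArg List.length h
  rw [length_code, length_code] at hlen
  obtain ⟨d, rfl⟩ := Nat.exists_eq_add_of_lt htt
  rw [add_assoc] at *
  by_cases hd : d + 1 ≤ 3
  · have := invBit_of_code_eq (v := []) (by simpa using h) (t := t) (d := d + 1) (by omega)
      (by omega) hd
    unfold invBit at this
    rw [decide_eq_decide] at this
    simpa [ht, hlen ▸ ht] using this
  · have h1 := getD_add_le hl t (d + 1) ht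
    have h2 := getD_add_le hl' t (d + 1) (by omega)
    constructor
    · intro hi; have := hi.le; omega
    · intro hi; have := hi.le; omega

/-- The bits of `l` that reach into `l'` are all zero, just as those that reach beyond the end of a
list. -/
theorem code_append {s : ℕ → Bool} {l l' : List ℕ}
    (h : ∀ p ∈ l, ∀ q ∈ l', ¬ Inv s p q) : code s (l ++ l') = code s l ++ code s l' := by
  have hleft : ∀ t < l.length, ∀ d, invBit s (l ++ l') t d = invBit s l t d := by
    intro t ht d
    unfold invBit
    congr 1
    apply propext
    rw [List.getD_append _ _ _ _ ht]
    by_cases htd : t + d < l.length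
    · rw [List.getD_append _ _ _ _ htd, List.length_append]
      exact and_congr_left fun _ => ⟨fun _ => htd, fun _ => by omega⟩
    · rw [List.getD_append_right _ _ _ _ (by omega)]
      constructor
      · rintro ⟨h1, h2⟩
        rw [List.length_append] at h1
        rw [List.getD_eq_getElem _ _ ht, List.getD_eq_getElem _ _ (by omega)] at h2
        exact absurd h2 (h _ (List.getElem_mem _) _ (List.getElem_mem _))
      · rintro ⟨h1, _⟩
        exact absurd h1 htd
  have hright : ∀ t, ∀ d, invBit s (l ++ l') (l.length + t) d = invBit s l' t d := by
    intro t d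
    unfold invBit
    congr 1
    apply propext
    rw [List.getD_append_right _ _ _ _ (by omega), List.getD_append_right _ _ _ _ (by omega),
      List.length_append]
    have e1 : l.length + t - l.length = t := by omega
    have e2 : l.length + t + d - l.length = t + d := by omega
    rw [e1, e2]
    exact and_congr_left fun _ => by omega
  apply List.ext_getElem
  · simp [length_code]
  · intro t ht ht'
    rw [length_code, List.length_append] at ht
    rw [getElem_code]
    by_cases h1 : t < l.length
    · rw [List.getElem_append_left (by rw [length_code]; omega), getElem_code, hleft t h1,
        hleft t h1, hleft t h1, List.getD_append _ _ _ _ h1]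
    · obtain ⟨d, rfl⟩ := Nat.exists_eq_add_of_le (not_lt.mp h1)
      rw [List.getElem_append_right (by rw [length_code]; omega), getElem_code]
      simp only [length_code, Nat.add_sub_cancel_left]
      rw [hright, hright, hright, List.getD_append_right _ _ _ _ (by omega),
        Nat.add_sub_cancel_left]

/-! ### Gridded permutations and codes -/

/-- The gridded permutation `σ` is formed by the pins at the places in `l`. -/
def FormedBy (s : ℕ → Bool) (σ : GridPerm) (l : List ℕ) : Prop :=
  σ.len = l.length ∧ (σ.horiz : ℕ) = 0 ∧
  -- Here `t` is a rank from the bottom and `σ.perm.symm t` the corresponding position from the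
  -- left.
  (∀ t : Fin σ.len, (σ.perm.symm t : ℕ) < (σ.vert : ℕ) ↔ s (l.getD t 0) = false) ∧
  ∀ t t' : Fin σ.len, t < t' →
    (σ.perm.symm t < σ.perm.symm t' ↔ LeftOf s (l.getD t 0) (l.getD t' 0))

theorem formedBy_ofFn {b : ℕ → Bool} {σ : GridPerm} {f : Fin σ.len → ℕ}
    (f1 : ∀ i j : Fin σ.len, i < j ↔
      (pinPoint (f i) (phiSeq b (f i))).1 < (pinPoint (f j) (phiSeq b (f j))).1)
    (f2 : ∀ i j : Fin σ.len, σ.perm i < σ.perm j ↔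
      (pinPoint (f i) (phiSeq b (f i))).2 < (pinPoint (f j) (phiSeq b (f j))).2)
    (f3 : ∀ i : Fin σ.len, (i : ℕ) < (σ.vert : ℕ) ↔ (pinPoint (f i) (phiSeq b (f i))).1 < 0)
    (h0 : (σ.horiz : ℕ) = 0) :
    (List.ofFn fun t : Fin σ.len => toPlace (f (σ.perm.symm t))).Pairwise (· < ·) ∧
    FormedBy (sideAt b) σ (List.ofFn fun t : Fin σ.len => toPlace (f (σ.perm.symm t))) := by
  have hlt : ∀ t t' : Fin σ.len, t < t' →
      toPlace (f (σ.perm.symm t)) < toPlace (f (σ.perm.symm t')) := by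
    intro t t' h
    rw [← pinPoint_snd_lt_iff b, ← f2]
    simpa using h
  have hget : ∀ t : Fin σ.len,
      (List.ofFn fun t : Fin σ.len => toPlace (f (σ.perm.symm t))).getD t 0 =
        toPlace (f (σ.perm.symm t)) := by
    intro t
    rw [List.getD_eq_getElem _ _ (by simp), List.getElem_ofFn]
  refine ⟨List.pairwise_ofFn.mpr hlt, by simp, h0, fun t => ?_, fun t t' h => ?_⟩
  · rw [hget, f3, pinPoint_fst_neg_iff]
  · rw [hget, hget, f1, pinPoint_fst_lt_iff b (hlt t t' h)]

theorem exists_formedBy {b : ℕ → Bool} {σ : GridPerm} (h : σ ∈ pinClass (phiSeq b)) :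
    ∃ l : List ℕ, l.Pairwise (· < ·) ∧ (∀ q ∈ l, q ≠ 1) ∧ FormedBy (sideAt b) σ l := by
  obtain ⟨f, f1, f2, f3, f4⟩ := h
  have h0 : (σ.horiz : ℕ) = 0 := by
    by_contra h
    have h1 := σ.horiz.2
    have h2 := f4 (σ.perm.symm ⟨0, by omega⟩)
    rw [Equiv.apply_symm_apply] at h2
    exact pinPoint_snd_pos _ _ (h2.mp (by simp only; omega))
  have := formedBy_ofFn f1 f2 f3 h0
  refine ⟨_, this.1, ?_, this.2⟩
  intro q hq
  obtain ⟨t, rfl⟩ := (List.mem_ofFn' _ _).mp hq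
  exact toPlace_ne_one _

theorem exists_mem_pinClass_formedBy (b : ℕ → Bool) {l : List ℕ} (hl : l.Pairwise (· < ·))
    (h1 : ∀ q ∈ l, q ≠ 1) : ∃ σ ∈ pinClass (phiSeq b), FormedBy (sideAt b) σ l := by
  have hto : ∀ i : Fin l.length, toPlace (pinAt (l.get i)) = l.get i :=
    fun i => toPlace_pinAt (h1 _ (List.get_mem _ _))
  have hinj : ∀ i j : Fin l.length, pinAt (l.get i) = pinAt (l.get j) → i = j := by
    intro i j h
    have h2 := congrArg toPlace h
    rw [hto, hto] at h2
    have hnd : l.Nodup := hl.imp fun h => ne_of_lt h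
    exact hnd.injective_get h2
  let p : Fin l.length → ℤ × ℤ := fun i => pinPoint (pinAt (l.get i)) (phiSeq b (pinAt (l.get i)))
  obtain ⟨e, e1, e2, e3, e4⟩ := exists_equiv_ofPoints p
    (fun i j h => hinj i j (pinPoint_fst_inj h)) (fun i j h => hinj i j (pinPoint_snd_inj h))
  have h0 : ((ofPoints p).horiz : ℕ) = 0 := by
    change (Finset.univ.filter fun i => (p i).2 < 0).card = 0
    rw [Finset.card_eq_zero, Finset.filter_eq_empty_iff]
    exact fun i _ => pinPoint_snd_pos _ _
  refine ⟨ofPoints p, ⟨fun i => pinAt (l.get (e i)), e1, e2, e3, e4⟩, ?_⟩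
  have key := formedBy_ofFn (σ := ofPoints p) (f := fun i => pinAt (l.get (e i))) e1 e2 e3 h0
  -- Both lists are increasing and have the same members.
  have hl' : (List.ofFn fun t : Fin (ofPoints p).len =>
      toPlace (pinAt (l.get (e ((ofPoints p).perm.symm t))))) = l := by
    refine key.1.eq_of_mem_iff hl ?_
    intro q
    rw [List.mem_ofFn']
    constructor
    · rintro ⟨t, rfl⟩
      exact (congrArg (· ∈ l) (hto (e ((ofPoints p).perm.symm t)))).mpr (List.get_mem _ _)
    · intro hq
      obtain ⟨n, rfl⟩ := List.get_of_mem hq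
      refine ⟨(ofPoints p).perm (e.symm n), ?_⟩
      have : e ((ofPoints p).perm.symm ((ofPoints p).perm (e.symm n))) = n := by
        erw [Equiv.symm_apply_apply, Equiv.apply_symm_apply]
      exact (congrArg (fun i => toPlace (pinAt (l.get i))) this).trans (hto n)
  rw [hl'] at key
  exact key.2

/-- Sides and horizontal order determine the inversions, so the code depends only on the gridded
permutation. -/
theorem inv_iff_leftOf {s : ℕ → Bool} {p q : ℕ} :
    Inv s p q ↔ s p = s q ∧ (s p = true ↔ ¬ LeftOf s p q) := by
  unfold LeftOf
  by_cases h : Inv s p q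
  · have := h.2.2
    simp only [h, true_iff]
    cases hp : s p <;> cases hq : s q <;> simp_all
  · simp only [h, false_iff]
    cases hp : s p <;> cases hq : s q <;> simp_all

theorem code_eq_of_formedBy {s : ℕ → Bool} {σ : GridPerm} {l l' : List ℕ}
    (h : FormedBy s σ l) (h' : FormedBy s σ l') : code s l = code s l' := by
  obtain ⟨a1, _, a3, a4⟩ := h
  obtain ⟨b1, _, b3, b4⟩ := h'
  have hs : ∀ t < l.length, s (l.getD t 0) = s (l'.getD t 0) := by
    intro t ht
    have := (a3 ⟨t, by omega⟩).symm.trans (b3 ⟨t, by omega⟩)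
    simp only at this
    cases h1 : s (l.getD t 0) <;> cases h2 : s (l'.getD t 0) <;> simp_all
  refine code_congr (by omega) hs ?_
  intro t t' htt ht
  rw [inv_iff_leftOf, inv_iff_leftOf, hs t (by omega), hs t' ht]
  have h1 := a4 ⟨t, by omega⟩ ⟨t', by omega⟩ htt
  have h2 := b4 ⟨t, by omega⟩ ⟨t', by omega⟩ htt
  rw [show LeftOf s (l.getD t 0) (l.getD t' 0) ↔ LeftOf s (l'.getD t 0) (l'.getD t' 0) from
    h1.symm.trans h2]

/-- The permutation `e.symm.trans e'` is an order automorphism of `Fin n`, hence trivial. -/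
theorem perm_eq_of_lt_iff {n : ℕ} {e e' : Equiv.Perm (Fin n)}
    (h : ∀ t t', e t < e t' ↔ e' t < e' t') : e = e' := by
  let o : Fin n ≃o Fin n :=
    { toEquiv := e.symm.trans e'
      map_rel_iff' := by
        intro a b
        simp only [Equiv.trans_apply]
        rw [← not_lt, ← not_lt, ← h]
        simp }
  have : o = OrderIso.refl _ := Subsingleton.elim _ _
  ext t
  have h1 := congrArg (fun o : Fin n ≃o Fin n => o (e t)) this
  simp only [OrderIso.refl_apply] at h1
  have h2 : o (e t) = e' t := by
    change e' (e.symm (e t)) = e' t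
    rw [Equiv.symm_apply_apply]
  rw [← h2, h1]

/-- The code gives back sides and inversions, hence the left-to-right order of the points listed by
height and the position of the vertical line. -/
theorem eq_of_formedBy_of_code_eq {s : ℕ → Bool} {σ σ' : GridPerm} {l l' : List ℕ}
    (hl : l.Pairwise (· < ·)) (hl' : l'.Pairwise (· < ·))
    (h : FormedBy s σ l) (h' : FormedBy s σ' l') (hc : code s l = code s l') : σ = σ' := by
  obtain ⟨a1, a2, a3, a4⟩ := h
  obtain ⟨b1, b2, b3, b4⟩ := h'
  have hlen := congrArg List.length hc
  rw [length_code, length_code] at hlen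
  obtain ⟨n, π, v, z⟩ := σ
  obtain ⟨n', π', v', z'⟩ := σ'
  obtain rfl : n = n' := by simp only at a1 b1; omega
  simp only at a1 a2 a3 a4 b1 b2 b3 b4
  have hlt : ∀ t t' : Fin n, t < t' →
      (π.symm t < π.symm t' ↔ π'.symm t < π'.symm t') := by
    intro t t' htt
    rw [a4 t t' htt, b4 t t' htt]
    have h1 := side_of_code_eq hc (t := t) (by omega)
    have h2 := side_of_code_eq hc (t := t') (by omega)
    have h3 := inv_iff_of_code_eq hl hl' hc htt (by omega)
    unfold LeftOf
    rw [h1, h2, h3]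
  have hπ : π.symm = π'.symm := by
    apply perm_eq_of_lt_iff
    intro t t'
    rcases lt_trichotomy t t' with h | h | h
    · exact hlt t t' h
    · simp [h]
    · have h1 := hlt t' t h
      have h2 : π.symm t' ≠ π.symm t := fun he => (ne_of_lt h) (π.symm.injective he)
      have h3 : π'.symm t' ≠ π'.symm t := fun he => (ne_of_lt h) (π'.symm.injective he)
      rw [← not_le, ← not_le, not_iff_not, le_iff_lt_or_eq, le_iff_lt_or_eq, h1]
      simp [h2, h3]
  have hπ' : π = π' := by
    rw [← Equiv.symm_symm π, hπ, Equiv.symm_symm]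
  subst hπ'
  have hv : ∀ i : Fin n, (i : ℕ) < (v : ℕ) ↔ (i : ℕ) < (v' : ℕ) := by
    intro i
    have h1 := a3 (π i)
    have h2 := b3 (π i)
    rw [Equiv.symm_apply_apply] at h1 h2
    rw [h1, h2, side_of_code_eq hc (t := π i) (by omega)]
  have hvv : v = v' := by
    apply Fin.ext
    have h1 := v.2
    have h2 := v'.2
    by_contra hne
    rcases Nat.lt_or_gt_of_ne hne with h | h
    · have := hv ⟨v, by omega⟩
      simp only at this; omega
    · have := hv ⟨v', by omega⟩
      simp only at this; omega
  have hzz : z = z' := Fin.ext (by omega)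
  rw [hvv, hzz]

/-- The codes of the members of length `n` of the pin class of `phiSeq b`. -/
def classCodes (b : ℕ → Bool) (n : ℕ) : Set (List CodeLetter) :=
  {v | ∃ l : List ℕ, l.Pairwise (· < ·) ∧ (∀ q ∈ l, q ≠ 1) ∧ l.length = n ∧ code (sideAt b) l = v}

/-- A permutation may be formed by several sets of pins; its code is the same for all, so the choice
of `L` is harmless. -/
theorem ncard_pinClass (b : ℕ → Bool) (n : ℕ) :
    {σ ∈ pinClass (phiSeq b) | σ.len = n}.ncard = (classCodes b n).ncard := by
  have hch : ∀ σ ∈ {σ ∈ pinClass (phiSeq b) | σ.len = n}, ∃ l : List ℕ,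
      l.Pairwise (· < ·) ∧ (∀ q ∈ l, q ≠ 1) ∧ FormedBy (sideAt b) σ l :=
    fun σ hσ => exists_formedBy hσ.1
  choose! L h1 h2 h3 using hch
  refine Set.ncard_congr (fun σ _ => code (sideAt b) (L σ)) ?_ ?_ ?_
  · intro σ hσ
    exact ⟨L σ, h1 σ hσ, h2 σ hσ, (h3 σ hσ).1.symm.trans hσ.2, rfl⟩
  · intro σ σ' hσ hσ' he
    exact eq_of_formedBy_of_code_eq (h1 σ hσ) (h1 σ' hσ') (h3 σ hσ) (h3 σ' hσ') he
  · rintro v ⟨l, hl, hl1, hn, rfl⟩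
    obtain ⟨σ, hσ, hf⟩ := exists_mem_pinClass_formedBy b hl hl1
    have hσ' : σ ∈ {σ ∈ pinClass (phiSeq b) | σ.len = n} := ⟨hσ, hf.1.trans hn⟩
    exact ⟨σ, hσ', code_eq_of_formedBy (h3 σ hσ') hf⟩

/-! ### Runs of consecutive pins -/

/-- The places of the pins `i, …, i + k - 1`, from bottom to top. -/
def run (i k : ℕ) : List ℕ :=
  (List.range (i + k + 2)).filter fun q => i + 2 * (q % 2) ≤ q ∧ q < i + k + 2 * (q % 2)

theorem mem_run {i k q : ℕ} : q ∈ run i k ↔ i + 2 * (q % 2) ≤ q ∧ q < i + k + 2 * (q % 2) := by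
  simp only [run, List.mem_filter, List.mem_range, decide_eq_true_eq]
  omega

theorem pairwise_run (i k : ℕ) : (run i k).Pairwise (· < ·) :=
  List.pairwise_lt_range.filter _

theorem nodup_of_pairwise {l : List ℕ} (h : l.Pairwise (· < ·)) : l.Nodup :=
  h.imp fun h => ne_of_lt h

theorem length_run (i k : ℕ) : (run i k).length = k := by
  have h : (run i k).Perm ((List.range' i k).map toPlace) := by
    rw [List.perm_ext_iff_of_nodup (nodup_of_pairwise (pairwise_run i k))]
    · intro q
      rw [mem_run, List.mem_map]
      constructor
      · rintro ⟨h1, h2⟩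
        refine ⟨pinAt q, ?_, toPlace_pinAt (by omega)⟩
        rw [List.mem_range'_1]
        unfold pinAt
        omega
      · rintro ⟨j, hj, rfl⟩
        rw [List.mem_range'_1] at hj
        unfold toPlace
        omega
    · refine List.Nodup.map ?_ List.nodup_range'
      intro a b hab
      rw [← pinAt_toPlace a, hab, pinAt_toPlace]
  rw [h.length_eq]
  simp

theorem sideAt_add_three (b : ℕ → Bool) {p : ℕ} (h : p % 2 = 0) :
    sideAt b p = sideAt b (p + 3) := by
  unfold sideAt pinAt
  congr 1
  omega

/-- The points of a run cannot be divided into a lower and an upper part without inversions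
between the parts. -/
theorem exists_inv_of_run (b : ℕ → Bool) {i k c : ℕ} (h : i % 2 = 0 ∨ k ≠ 2)
    (h1 : ∃ q ∈ run i k, q ≤ c) (h2 : ∃ q ∈ run i k, c < q) :
    ∃ p ∈ run i k, ∃ q ∈ run i k, p ≤ c ∧ c < q ∧ Inv (sideAt b) p q := by
  obtain ⟨q₁, hq₁, hc₁⟩ := h1
  obtain ⟨q₂, hq₂, hc₂⟩ := h2
  rw [mem_run] at hq₁ hq₂
  -- The side pin `p` and the next pin, at place `p + 3`, always form an inversion, so one such pair
  -- across the cut is enough. For odd `i` and `k = 2` the run contains no such pair.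
  have key : ∃ p, p % 2 = 0 ∧ i ≤ p ∧ p + 1 < i + k ∧ p ≤ c ∧ c < p + 3 := by
    rcases Nat.mod_two_eq_zero_or_one c with hc | hc
    · by_cases hi : i + 2 ≤ c
      · exact ⟨c - 2, by omega, by omega, by omega, by omega, by omega⟩
      · exact ⟨c, by omega, by omega, by omega, by omega, by omega⟩
    · exact ⟨c - 1, by omega, by omega, by omega, by omega, by omega⟩
  obtain ⟨p, hp, ha, hb, hc, hd⟩ := key
  exact ⟨p, mem_run.mpr (by omega), p + 3, mem_run.mpr (by omega), hc, hd, hp, Or.inr rfl,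
    sideAt_add_three b hp⟩

theorem getD_lt_getD_iff {l : List ℕ} (hl : l.Pairwise (· < ·)) {t t' : ℕ} (ht : t < l.length)
    (ht' : t' < l.length) : l.getD t 0 < l.getD t' 0 ↔ t < t' := by
  have hlt : ∀ a b, a < b → b < l.length → l.getD a 0 < l.getD b 0 := by
    intro a b hab hb
    have := getD_add_le hl a (b - a) (by omega)
    rw [Nat.add_sub_cancel' hab.le] at this
    omega
  constructor
  · intro h
    by_contra hc
    rcases Nat.lt_or_eq_of_le (not_lt.mp hc) with h1 | h1
    · have := hlt _ _ h1 ht; omega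
    · subst h1; omega
  · exact fun h => hlt _ _ h ht'

/-- Some inversion of the run crosses the end of a proper prefix. Its bit is set in the code of the
run, but in `code s l` a bit pointing beyond the list is zero. -/
theorem eq_nil_of_code_append_eq_code_run {s : ℕ → Bool} {b : ℕ → Bool} {l : List ℕ} {i k : ℕ}
    {v : List CodeLetter} (h : i % 2 = 0 ∨ k ≠ 2) (hl : l ≠ [])
    (he : code s l ++ v = code (sideAt b) (run i k)) : v = [] := by
  by_contra hv
  have hlen := congrArg List.length he
  rw [List.length_append, length_code, length_code] at hlen
  have hv' := List.length_pos_iff.mpr hv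
  have hl' := List.length_pos_iff.mpr hl
  have hmem : ∀ t < (run i k).length, (run i k).getD t 0 ∈ run i k := by
    intro t ht
    rw [List.getD_eq_getElem _ _ ht]
    exact List.getElem_mem _
  have hs := pairwise_run i k
  obtain ⟨p, hp, q, hq, hpc, hqc, hinv⟩ := exists_inv_of_run b (c := (run i k).getD (l.length - 1) 0)
    h ⟨_, hmem (l.length - 1) (by omega), le_rfl⟩
    ⟨_, hmem l.length (by omega), (getD_lt_getD_iff hs (by omega) (by omega)).mpr (by omega)⟩
  obtain ⟨t, ht, rfl⟩ := List.getElem_of_mem hp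
  obtain ⟨t', ht', rfl⟩ := List.getElem_of_mem hq
  rw [← List.getD_eq_getElem _ 0] at hpc hqc hinv
  rw [← List.getD_eq_getElem _ 0 ht'] at hinv
  have h1 : t < l.length := by
    by_contra hc
    have := (getD_lt_getD_iff hs (t := l.length - 1) (t' := t) (by omega) ht).mpr (by omega)
    omega
  have h2 := (getD_lt_getD_iff hs (by omega) ht').mp hqc
  obtain ⟨d, rfl⟩ := Nat.exists_eq_add_of_le (show t ≤ t' by omega)
  have h3 := getD_add_le hs t d ht'
  have h4 := hinv.le
  have h5 := invBit_of_code_eq he h1 (d := d) (by omega) (by omega)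
  have h6 : invBit (sideAt b) (run i k) t d = true := by
    unfold invBit
    rw [decide_eq_true_eq]
    exact ⟨ht', hinv⟩
  rw [h6] at h5
  unfold invBit at h5
  rw [decide_eq_true_eq] at h5
  omega

/-! ### Codes of box-indecomposable runs with at most one zero -/

/-- The code of a run of pins of the pin sequence with a single zero at position `z`. -/
def runCode (i k z : ℕ) : List CodeLetter := code (sideAt (zeroAt z)) (run i k)

/-- The codes of the box-indecomposable runs of `k` pins with at most one zero. -/
def items (k : ℕ) : Finset (List CodeLetter) :=
  if k = 2 then {runCode 0 2 0, runCode 0 2 1} else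
    -- Runs starting at 0 touch the letters up to `(k - 1) / 2`, those starting at 1 the letters up
    -- to `k / 2`; one further value of the zero position stands for no zero.
    (Finset.range ((k - 1) / 2 + 2)).image (runCode 0 k) ∪
      (Finset.range (k / 2 + 2)).image (runCode 1 k)

/-- The number of codes of length `k` of box-indecomposable runs with at most one zero. -/
def itemCount (k : ℕ) : ℕ := if k ≤ 2 then 2 else if k = 3 then 4 else k + 3

theorem exists_of_mem_items {k : ℕ} {x : List CodeLetter} (hx : x ∈ items k) :
    ∃ i z, (i % 2 = 0 ∨ k ≠ 2) ∧ i ≤ 1 ∧ z ≤ k + 1 ∧ x = runCode i k z := by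
  unfold items at hx
  split_ifs at hx with hk
  · rw [Finset.mem_insert, Finset.mem_singleton] at hx
    subst hk
    rcases hx with rfl | rfl
    · exact ⟨0, 0, Or.inl rfl, by omega, by omega, rfl⟩
    · exact ⟨0, 1, Or.inl rfl, by omega, by omega, rfl⟩
  · rw [Finset.mem_union, Finset.mem_image, Finset.mem_image] at hx
    rcases hx with ⟨z, hz, rfl⟩ | ⟨z, hz, rfl⟩
    · rw [Finset.mem_range] at hz
      exact ⟨0, z, Or.inl rfl, by omega, by omega, rfl⟩
    · rw [Finset.mem_range] at hz
      exact ⟨1, z, Or.inr hk, by omega, by omega, rfl⟩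

theorem length_of_mem_items {k : ℕ} {x : List CodeLetter} (hx : x ∈ items k) : x.length = k := by
  obtain ⟨i, z, -, -, -, rfl⟩ := exists_of_mem_items hx
  rw [runCode, length_code, length_run]

/-- The items form a prefix code. -/
theorem eq_of_items_append_eq {k k' : ℕ} (hk : 0 < k) (hk' : 0 < k') {x x' v v' : List CodeLetter}
    (hx : x ∈ items k) (hx' : x' ∈ items k') (h : x ++ v = x' ++ v') : x = x' := by
  obtain ⟨i, z, hi, -, -, rfl⟩ := exists_of_mem_items hx
  obtain ⟨i', z', hi', -, -, rfl⟩ := exists_of_mem_items hx'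
  have hne : ∀ i k, 0 < k → run i k ≠ [] := by
    intro i k hk he
    have := congrArg List.length he
    rw [length_run] at this
    simp at this
    omega
  rcases List.append_eq_append_iff.mp h with ⟨a, ha, -⟩ | ⟨a, ha, -⟩
  · have := eq_nil_of_code_append_eq_code_run hi' (hne i k hk) ha.symm
    rw [ha, this, List.append_nil]
  · have := eq_nil_of_code_append_eq_code_run hi (hne i' k' hk') ha.symm
    rw [ha, this, List.append_nil]

theorem run_zero_eq {k : ℕ} (hk : 3 ≤ k) :
    run 0 k = 0 :: 2 :: 3 :: (run 0 k).filter (3 < ·) := by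
  refine (pairwise_run 0 k).eq_of_mem_iff ?_ ?_
  · have h := (pairwise_run 0 k).filter (3 < ·)
    refine List.Pairwise.cons ?_ (List.Pairwise.cons ?_ (List.Pairwise.cons ?_ h)) <;>
      simp <;> omega
  · intro q
    simp only [List.mem_cons, List.mem_filter, mem_run, decide_eq_true_eq]
    omega

theorem run_one_eq {k : ℕ} (hk : 4 ≤ k) :
    run 1 k = 2 :: 3 :: 4 :: 5 :: (run 1 k).filter (5 < ·) := by
  refine (pairwise_run 1 k).eq_of_mem_iff ?_ ?_
  · have h := (pairwise_run 1 k).filter (5 < ·)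
    refine List.Pairwise.cons ?_ (List.Pairwise.cons ?_ (List.Pairwise.cons ?_
      (List.Pairwise.cons ?_ h))) <;> simp <;> omega
  · intro q
    simp only [List.mem_cons, List.mem_filter, mem_run, decide_eq_true_eq]
    omega

/-- An odd start gives the lowest places 2, 3, 4, 5, with an inversion between the first and the
fourth. An even start gives 0, 2, 3 and then a place above 3, too high for an inversion with the
first. -/
theorem runCode_zero_ne_runCode_one {k : ℕ} (hk : 4 ≤ k) (z z' : ℕ) :
    runCode 0 k z ≠ runCode 1 k z' := by
  intro h
  have h1 : invBit (sideAt (zeroAt z)) (run 0 k) 0 3 = invBit (sideAt (zeroAt z')) (run 1 k) 0 3 :=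
    invBit_of_code_eq (v := []) (by rw [List.append_nil]; exact h) (by rw [length_run]; omega)
      (by omega) (by omega)
  have h2 : invBit (sideAt (zeroAt z')) (run 1 k) 0 3 = true := by
    unfold invBit
    rw [decide_eq_true_eq, zero_add]
    have e0 : (run 1 k).getD 0 0 = 2 := by rw [run_one_eq hk]; rfl
    have e3 : (run 1 k).getD 3 0 = 5 := by rw [run_one_eq hk]; rfl
    rw [e0, e3, length_run]
    exact ⟨by omega, rfl, Or.inr rfl, sideAt_add_three _ rfl⟩
  rw [h2] at h1
  unfold invBit at h1
  rw [decide_eq_true_eq] at h1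
  have h3 : _ ≤ (run 0 k).getD 3 0 := getD_add_le (pairwise_run 0 k) 2 1 h1.1
  have h4 : (run 0 k).getD 3 0 ≤ _ := h1.2.le
  have e0 : (run 0 k).getD 0 0 = 0 := by rw [run_zero_eq (by omega)]; rfl
  have e2 : (run 0 k).getD 2 0 = 3 := by rw [run_zero_eq (by omega)]; rfl
  rw [e0] at h4
  rw [e2] at h3
  omega

/-- The sides reveal the zero: of two positions in the range, the smaller one is always touched by
the run. -/
theorem runCode_injOn (i k n : ℕ) (hn : n ≤ (i + k - 1) / 2 + 2) (hi : i ≤ 1) (hk : 0 < k) :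
    Set.InjOn (runCode i k) (Finset.range n : Set ℕ) := by
  have key : ∀ z z', z < z' → z' < n → runCode i k z ≠ runCode i k z' := by
    intro z z' hzz hz' h
    have hq : ∃ q ∈ run i k, pinAt q / 2 = z := by
      by_cases h2 : i ≤ 2 * z
      · exact ⟨2 * z, mem_run.mpr (by omega), by unfold pinAt; omega⟩
      · exact ⟨2 * z + 3, mem_run.mpr (by omega), by unfold pinAt; omega⟩
    obtain ⟨q, hq, hqz⟩ := hq
    obtain ⟨t, ht, rfl⟩ := List.getElem_of_mem hq
    have := side_of_code_eq h ht
    rw [List.getD_eq_getElem _ _ ht] at this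
    unfold sideAt zeroAt at this
    rw [hqz] at this
    simp at this
    omega
  intro z hz z' hz' h
  simp only [Finset.coe_range, Set.mem_Iio] at hz hz'
  rcases lt_trichotomy z z' with h1 | h1 | h1
  · exact absurd h (key _ _ h1 hz')
  · exact h1
  · exact absurd h.symm (key _ _ h1 hz)

theorem card_items {k : ℕ} (hk : 0 < k) : (items k).card = itemCount k := by
  by_cases h3 : k ≤ 3
  -- For `k = 1` and `k = 3` the two starting parities share codes, so the general count fails.
  · interval_cases k
    · decide
    · decide
    · decide
  · unfold items itemCount
    rw [if_neg (by omega), if_neg (by omega), if_neg (by omega), Finset.card_union_of_disjoint,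
      Finset.card_image_of_injOn (runCode_injOn 0 k _ (by omega) (by omega) hk),
      Finset.card_image_of_injOn (runCode_injOn 1 k _ (by omega) (by omega) hk),
      Finset.card_range, Finset.card_range]
    · omega
    · rw [Finset.disjoint_left]
      intro x hx hx'
      obtain ⟨z, -, rfl⟩ := Finset.mem_image.mp hx
      obtain ⟨z', -, h⟩ := Finset.mem_image.mp hx'
      exact runCode_zero_ne_runCode_one (by omega) z z' h.symm

/-- Only even shifts are admitted, since `Inv` depends on the parity of the lower place. -/
theorem Inv.congr {s s' : ℕ → Bool} {p q m : ℕ} (hp : s (p + 2 * m) = s' p)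
    (hq : s (q + 2 * m) = s' q) : Inv s (p + 2 * m) (q + 2 * m) ↔ Inv s' p q := by
  unfold Inv
  rw [hp, hq]
  constructor <;> rintro ⟨h1, h2, h3⟩ <;> exact ⟨by omega, by omega, h3⟩

theorem code_map_add {s s' : ℕ → Bool} {l : List ℕ} {m : ℕ}
    (h : ∀ q ∈ l, s (q + 2 * m) = s' q) : code s (l.map (· + 2 * m)) = code s' l := by
  have hget : ∀ t < l.length, (l.map (· + 2 * m)).getD t 0 = l.getD t 0 + 2 * m := by
    intro t ht
    rw [List.getD_eq_getElem _ _ (by simpa using ht), List.getD_eq_getElem _ _ ht, List.getElem_map]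
  have hs : ∀ t < l.length, s (l.getD t 0 + 2 * m) = s' (l.getD t 0) := by
    intro t ht
    rw [List.getD_eq_getElem _ _ ht]
    exact h _ (List.getElem_mem _)
  refine code_congr (by simp) (fun t ht => ?_) (fun t t' htt ht => ?_)
  · rw [List.length_map] at ht
    rw [hget t ht, hs t ht]
  · rw [List.length_map] at ht
    rw [hget t (by omega), hget t' ht]
    exact Inv.congr (hs t (by omega)) (hs t' ht)

theorem pairwise_map_add {l : List ℕ} (h : l.Pairwise (· < ·)) (m : ℕ) :
    (l.map (· + m)).Pairwise (· < ·) := by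
  rw [List.pairwise_map]
  exact h.imp fun h => by omega

theorem run_add (i k m : ℕ) : run (i + 2 * m) k = (run i k).map (· + 2 * m) := by
  refine (pairwise_run _ _).eq_of_mem_iff (pairwise_map_add (pairwise_run i k) _) ?_
  intro q
  rw [mem_run, List.mem_map]
  constructor
  · intro h
    exact ⟨q - 2 * m, mem_run.mpr (by omega), by omega⟩
  · rintro ⟨r, hr, rfl⟩
    rw [mem_run] at hr
    omega

theorem sideAt_add_two_mul {b : ℕ → Bool} {q m : ℕ} (hq : q ≠ 1) :
    sideAt b (q + 2 * m) = b (m + pinAt q / 2) := by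
  unfold sideAt pinAt
  congr 1
  omega

/-! ### Codes that can be realized arbitrarily far from the origin -/

/-- The codes of length `n` of sets of pins of `phiSeq bStar` that lie arbitrarily far from the
origin. -/
def farCodes (n : ℕ) : Set (List CodeLetter) :=
  {v | ∀ N, ∃ l : List ℕ, l.Pairwise (· < ·) ∧ (∀ q ∈ l, N ≤ q) ∧ l.length = n ∧
    code (sideAt bStar) l = v}

theorem farCodes_subset (n : ℕ) : farCodes n ⊆ classCodes bStar n := by
  intro v hv
  obtain ⟨l, h1, h2, h3, h4⟩ := hv 2
  exact ⟨l, h1, fun q hq => by have := h2 q hq; omega, h3, h4⟩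

theorem nil_mem_farCodes : [] ∈ farCodes 0 := fun _ =>
  ⟨[], List.Pairwise.nil, by simp, rfl, rfl⟩

/-- The item is placed around an isolated zero beyond `N`, and `v` is realized still farther out. -/
theorem append_mem_farCodes {k n : ℕ} {x v : List CodeLetter} (hx : x ∈ items k)
    (hv : v ∈ farCodes n) : x ++ v ∈ farCodes (k + n) := by
  intro N
  obtain ⟨i, z, -, hi, hz, rfl⟩ := exists_of_mem_items hx
  obtain ⟨y, hy, hy'⟩ := exists_isolated_zero N (k + 2 + z)
  have hside : ∀ q ∈ run i k, sideAt bStar (q + 2 * (y - z)) = sideAt (zeroAt z) q := by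
    intro q hq
    rw [mem_run] at hq
    have hp : pinAt q < i + k := by unfold pinAt; omega
    rw [sideAt_add_two_mul (by omega), hy' _ (by omega) (by omega)]
    unfold sideAt zeroAt
    rw [decide_eq_decide]
    omega
  -- This is more than three places above the run, so no inversion crosses.
  obtain ⟨l, h1, h2, h3, h4⟩ := hv (i + k + 2 * y + 6)
  refine ⟨run (i + 2 * (y - z)) k ++ l, ?_, ?_, ?_, ?_⟩
  · rw [List.pairwise_append]
    refine ⟨pairwise_run _ _, h1, fun p hp q hq => ?_⟩
    rw [mem_run] at hp
    have := h2 q hq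
    omega
  · intro q hq
    rw [List.mem_append, mem_run] at hq
    rcases hq with hq | hq
    · omega
    · have := h2 q hq; omega
  · rw [List.length_append, length_run, h3]
  · rw [code_append, run_add, code_map_add hside, h4]
    · rfl
    · intro p hp q hq hinv
      rw [mem_run] at hp
      have := h2 q hq
      have := hinv.le
      omega

theorem finite_farCodes (n : ℕ) : (farCodes n).Finite := by
  refine (List.finite_length_eq CodeLetter n).subset fun v hv => ?_
  obtain ⟨l, -, -, h3, rfl⟩ := hv 0
  rw [Set.mem_ofPred_eq, length_code, h3]

theorem finite_classCodes (b : ℕ → Bool) (n : ℕ) : (classCodes b n).Finite := by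
  refine (List.finite_length_eq CodeLetter n).subset ?_
  rintro v ⟨l, -, -, h3, rfl⟩
  rw [Set.mem_ofPred_eq, length_code, h3]

/-- By the prefix property, `(x, v) ↦ x ++ v` is injective over all lengths of `x`. -/
theorem sum_mul_ncard_farCodes_le (n : ℕ) :
    ∑ k ∈ Finset.Icc 1 n, itemCount k * (farCodes (n - k)).ncard ≤ (farCodes n).ncard := by
  have e : ∀ m, (farCodes m).ncard = (finite_farCodes m).toFinset.card := fun m =>
    Set.ncard_eq_toFinset_card _ _
  have h1 : ∑ k ∈ Finset.Icc 1 n, itemCount k * (farCodes (n - k)).ncard =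
      ((Finset.Icc 1 n).sigma fun k => items k ×ˢ (finite_farCodes (n - k)).toFinset).card := by
    rw [Finset.card_sigma]
    refine Finset.sum_congr rfl fun k hk => ?_
    rw [Finset.mem_Icc] at hk
    rw [Finset.card_product, card_items (by omega), e]
  rw [h1, e]
  refine Finset.card_le_card_of_injOn (fun a => a.2.1 ++ a.2.2) ?_ ?_
  · rintro ⟨k, x, v⟩ h
    simp only [Finset.coe_sigma, Set.mem_sigma_iff, Finset.mem_coe, Finset.mem_Icc,
      Finset.mem_product, Set.Finite.mem_toFinset] at h ⊢
    have := append_mem_farCodes h.2.1 h.2.2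
    rwa [Nat.add_sub_cancel' h.1.2] at this
  · rintro ⟨k, x, v⟩ h ⟨k', x', v'⟩ h' he
    simp only [Finset.coe_sigma, Set.mem_sigma_iff, Finset.mem_coe, Finset.mem_Icc,
      Finset.mem_product, Set.Finite.mem_toFinset] at h h' he
    have hxx := eq_of_items_append_eq (by omega) (by omega) h.2.1 h'.2.1 he
    subst hxx
    have hk : k = k' := by rw [← length_of_mem_items h.2.1, length_of_mem_items h'.2.1]
    subst hk
    have hv := List.append_cancel_left he
    subst hv
    rfl

/-! ### Codes of sets of pins in a tail -/

/-- The codes of sets of `n` pins of `phiSeq b` from the `N`-th pin on. -/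
def tailCodes (b : ℕ → Bool) (N n : ℕ) : Set (List CodeLetter) :=
  {v | ∃ l : List ℕ, l.Pairwise (· < ·) ∧ (∀ q ∈ l, N + 2 * (q % 2) ≤ q) ∧ l.length = n ∧
    code (sideAt b) l = v}

theorem finite_tailCodes (b : ℕ → Bool) (N n : ℕ) : (tailCodes b N n).Finite := by
  refine (List.finite_length_eq CodeLetter n).subset ?_
  rintro v ⟨l, -, -, h3, rfl⟩
  rw [Set.mem_ofPred_eq, length_code, h3]

/-- A set of pins that does not contain the `j`-th pin splits into a part before and a part after
this pin, and its code splits accordingly. -/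
theorem split_at_missing {l : List ℕ} (hl : l.Pairwise (· < ·)) (h1 : ∀ q ∈ l, q ≠ 1) {j : ℕ}
    (hj : toPlace j ∉ l) (s : ℕ → Bool) :
    l = l.filter (fun q => q < j + 2 * (q % 2)) ++ l.filter (fun q => j + 1 + 2 * (q % 2) ≤ q) ∧
    code s l = code s (l.filter fun q => q < j + 2 * (q % 2)) ++
      code s (l.filter fun q => j + 1 + 2 * (q % 2) ≤ q) := by
  have h : l = l.filter (fun q => q < j + 2 * (q % 2)) ++
      l.filter (fun q => j + 1 + 2 * (q % 2) ≤ q) := by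
    refine hl.eq_of_mem_iff ?_ ?_
    · rw [List.pairwise_append]
      refine ⟨hl.filter _, hl.filter _, ?_⟩
      intro p hp q hq
      rw [List.mem_filter, decide_eq_true_eq] at hp hq
      omega
    · intro q
      simp only [List.mem_append, List.mem_filter, decide_eq_true_eq]
      constructor
      · intro hq
        have : q ≠ toPlace j := fun he => hj (he ▸ hq)
        have := h1 q hq
        unfold toPlace at *
        by_cases hc : q < j + 2 * (q % 2)
        · exact Or.inl ⟨hq, hc⟩
        · exact Or.inr ⟨hq, by omega⟩
      · rintro (hq | hq)
        exacts [hq.1, hq.1]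
  refine ⟨h, ?_⟩
  rw [← code_append, ← h]
  -- Inverted pins have consecutive indices, whereas here the indices lie on different sides of `j`.
  intro p hp q hq hinv
  rw [List.mem_filter, decide_eq_true_eq] at hp hq
  have h2 := hinv.1
  have h3 := hinv.2.1
  omega

theorem exists_missing (l : List ℕ) (i : ℕ) :
    ∃ j, i ≤ j ∧ toPlace j ∉ l ∧ ∀ i', i ≤ i' → i' < j → toPlace i' ∈ l := by
  have hex : ∃ j, i ≤ j ∧ toPlace j ∉ l := by
    refine ⟨i + (l.sum + 1), by omega, fun h => ?_⟩
    have := List.le_sum_of_mem h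
    unfold toPlace at this
    omega
  classical
  refine ⟨Nat.find hex, (Nat.find_spec hex).1, (Nat.find_spec hex).2, fun i' h1 h2 => ?_⟩
  by_contra hc
  exact Nat.find_min hex h2 ⟨h1, hc⟩

/-- The run of `k` pins of `phiSeq b` from the `i`-th pin on touches at most one zero. -/
def AtMostOneZero (b : ℕ → Bool) (i k : ℕ) : Prop :=
  ∀ z z', z < z' → i ≤ 2 * z + 1 → 2 * z' < i + k → b z = false → b z' = true

theorem exists_code_run_eq {b : ℕ → Bool} {i k : ℕ} (hk : 0 < k) (h : AtMostOneZero b i k) :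
    ∃ z, z ≤ (i % 2 + k - 1) / 2 + 1 ∧ code (sideAt b) (run i k) = runCode (i % 2) k z := by
  have key : ∀ z, (∀ q ∈ run (i % 2) k, b (i / 2 + pinAt q / 2) = zeroAt z (pinAt q / 2)) →
      code (sideAt b) (run i k) = runCode (i % 2) k z := by
    intro z hz
    have e : run i k = run (i % 2 + 2 * (i / 2)) k := by congr 1; omega
    rw [e, run_add]
    refine code_map_add fun q hq => ?_
    have := mem_run.mp hq
    rw [sideAt_add_two_mul (by omega), hz q hq]
    rfl
  by_cases hz : ∃ z, i ≤ 2 * z + 1 ∧ 2 * z < i + k ∧ b z = false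
  · obtain ⟨z, h1, h2, h3⟩ := hz
    refine ⟨z - i / 2, by omega, key _ fun q hq => ?_⟩
    rw [mem_run] at hq
    have hp : i % 2 ≤ pinAt q ∧ pinAt q < i % 2 + k := by unfold pinAt; omega
    unfold zeroAt
    rcases lt_trichotomy (i / 2 + pinAt q / 2) z with hc | hc | hc
    · have : b (i / 2 + pinAt q / 2) = true := by
        by_contra hb
        rw [Bool.not_eq_true] at hb
        rw [h _ _ hc (by omega) (by omega) hb] at h3
        exact absurd h3 (by decide)
      rw [this]
      symm
      rw [decide_eq_true_eq]
      omega
    · rw [hc, h3]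
      symm
      rw [decide_eq_false_iff_not]
      omega
    · rw [h _ _ hc (by omega) (by omega) h3]
      symm
      rw [decide_eq_true_eq]
      omega
  · push Not at hz
    -- A zero just past the last touched letter represents a run of ones.
    refine ⟨(i % 2 + k - 1) / 2 + 1, le_rfl, key _ fun q hq => ?_⟩
    rw [mem_run] at hq
    have hp : i % 2 ≤ pinAt q ∧ pinAt q < i % 2 + k := by unfold pinAt; omega
    have := hz (i / 2 + pinAt q / 2) (by omega) (by omega)
    rw [Bool.ne_false_iff] at this
    rw [this, zeroAt]
    symm
    rw [decide_eq_true_eq]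
    omega

theorem runCode_mem_items {i k z : ℕ} (hi : i ≤ 1) (hk : 0 < k) (hz : z ≤ (i + k - 1) / 2 + 1)
    (h : i = 0 ∨ k ≠ 2) : runCode i k z ∈ items k := by
  unfold items
  split_ifs with h2
  · obtain rfl : i = 0 := by omega
    subst h2
    rw [Finset.mem_insert, Finset.mem_singleton]
    have : z = 0 ∨ z = 1 := by omega
    rcases this with rfl | rfl
    · exact Or.inl rfl
    · exact Or.inr rfl
  · rw [Finset.mem_union, Finset.mem_image, Finset.mem_image]
    have : i = 0 ∨ i = 1 := by omega
    rcases this with rfl | rfl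
    · exact Or.inl ⟨z, Finset.mem_range.mpr (by omega), rfl⟩
    · exact Or.inr ⟨z, Finset.mem_range.mpr (by omega), rfl⟩

/-- The codes of runs of `k` pins of `phiSeq bStar` from the `N`-th pin on that touch at least two
zeros are among these. -/
def longItems (N k : ℕ) : Finset (List CodeLetter) :=
  if N ≤ k ^ 2 then
    (Finset.range (k ^ 2 + 1)).image fun i => code (sideAt bStar) (run i k) else ∅

theorem card_longItems_le (N k : ℕ) :
    (longItems N k).card ≤ if N ≤ k ^ 2 then k ^ 2 + 1 else 0 := by
  unfold longItems
  split_ifs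
  · exact Finset.card_image_le.trans (by simp)
  · simp

/-- Two touched zeros are at most `k / 2` apart, so the gap bound puts the first one, and hence the
start of the run, at most at `k ^ 2`. -/
theorem code_run_mem_longItems {N i k : ℕ} (hN : N ≤ i) (h : ¬ AtMostOneZero bStar i k) :
    code (sideAt bStar) (run i k) ∈ longItems N k := by
  unfold AtMostOneZero at h
  push Not at h
  obtain ⟨z, z', hzz, h1, h2, h3, h4⟩ := h
  replace h4 : bStar z' = false := by simpa using h4
  have h5 := lt_sq_of_bStar_eq_false h3 h4 hzz
  have h6 : (z' - z) * 2 ≤ k := by omega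
  have h7 : i ≤ k ^ 2 := by nlinarith
  unfold longItems
  rw [if_pos (by omega), Finset.mem_image]
  exact ⟨i, by rw [Finset.mem_range]; omega, rfl⟩

/-- The maximal run from the smallest index `i` on is split off at the first missing pin `j`. It is
an item, a long item, or a pair with odd start, which needs separate treatment. -/
theorem exists_append_of_mem_tailCodes {N n : ℕ} (hn : 0 < n) {v : List CodeLetter}
    (hv : v ∈ tailCodes bStar N n) :
    ∃ k ∈ Finset.Icc 1 n, ∃ x ∈ items k ∪ longItems N k, ∃ v' ∈ tailCodes bStar N (n - k),
      x ++ v' = v := by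
  obtain ⟨l, hl, hN, hlen, rfl⟩ := hv
  have hex : ∃ i, toPlace i ∈ l := by
    have hpos : 0 < l.length := by omega
    have hm := List.getElem_mem hpos
    refine ⟨pinAt l[0], ?_⟩
    rw [toPlace_pinAt]
    · exact hm
    · have := hN _ hm; omega
  classical
  set i := Nat.find hex with hi
  have hi1 : toPlace i ∈ l := Nat.find_spec hex
  have hi2 : ∀ q ∈ l, i + 2 * (q % 2) ≤ q := by
    intro q hq
    have h1 := hN q hq
    have h2 : i ≤ pinAt q := Nat.find_min' hex (by rwa [toPlace_pinAt (by omega)])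
    unfold pinAt at h2
    omega
  have hNi : N ≤ i := by
    have := hN _ hi1
    unfold toPlace at this
    omega
  obtain ⟨j, hij, hj, hij'⟩ := exists_missing l i
  have hlt : i < j := by
    rcases Nat.lt_or_eq_of_le hij with h | h
    · exact h
    · exact absurd (h ▸ hi1) hj
  have hsplit := split_at_missing hl (fun q hq => by have := hi2 q hq; omega) hj (sideAt bStar)
  have hrun : l.filter (fun q => q < j + 2 * (q % 2)) = run i (j - i) := by
    refine (hl.filter _).eq_of_mem_iff (pairwise_run _ _) fun q => ?_
    rw [List.mem_filter, decide_eq_true_eq, mem_run]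
    constructor
    · rintro ⟨h1, h2⟩
      have := hi2 q h1
      omega
    · rintro ⟨h1, h2⟩
      refine ⟨?_, by omega⟩
      rw [← toPlace_pinAt (q := q) (by omega)]
      exact hij' _ (by unfold pinAt; omega) (by unfold pinAt; omega)
  rw [hrun] at hsplit
  set l₂ := l.filter (fun q => j + 1 + 2 * (q % 2) ≤ q) with hl₂
  have hl₂' : ∀ q ∈ l₂, j + 1 + 2 * (q % 2) ≤ q := by
    intro q hq
    rw [hl₂, List.mem_filter, decide_eq_true_eq] at hq
    exact hq.2
  have hlen₂ : (j - i) + l₂.length = n := by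
    have := congrArg List.length hsplit.1
    rw [List.length_append, length_run] at this
    omega
  have htail : code (sideAt bStar) l₂ ∈ tailCodes bStar N (n - (j - i)) :=
    ⟨l₂, hl.filter _, fun q hq => by have := hl₂' q hq; omega, by omega, rfl⟩
  have hmem : j - i ∈ Finset.Icc 1 n := Finset.mem_Icc.mpr (by omega)
  by_cases hz : AtMostOneZero bStar i (j - i)
  · by_cases hsp : i % 2 = 0 ∨ j - i ≠ 2
    · obtain ⟨z, hz1, hz2⟩ := exists_code_run_eq (by omega) hz
      refine ⟨j - i, hmem, _, ?_, _, htail, hsplit.2.symm⟩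
      rw [Finset.mem_union, hz2]
      exact Or.inl (runCode_mem_items (by omega) (by omega) hz1 (by omega))
    · push Not at hsp
      -- The pair consists of the up pin `i`, at place `i + 2`, and the lower side pin `i + 1`, at
      -- place `i + 1`; they belong to adjacent binary letters.
      have hji : j = i + 2 := by omega
      have hr : run i (j - i) = [i + 1, i + 2] := by
        refine (pairwise_run _ _).eq_of_mem_iff (by simp) fun q => ?_
        rw [mem_run]
        simp only [List.mem_cons, List.not_mem_nil, or_false]
        omega
      by_cases hside : sideAt bStar (i + 1) = sideAt bStar (i + 2)
      · have htrue : sideAt bStar (i + 1) = true ∧ sideAt bStar (i + 2) = true := by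
          rw [← hside, and_self]
          by_contra hf
          rw [Bool.not_eq_true] at hf
          have hf' := hside.symm.trans hf
          have e1 : sideAt bStar (i + 2) = bStar (i / 2) := by
            unfold sideAt pinAt; congr 1; omega
          have e2 : sideAt bStar (i + 1) = bStar (i / 2 + 1) := by
            unfold sideAt pinAt; congr 1; omega
          rw [e1] at hf'
          rw [e2] at hf
          have := hz (i / 2) (i / 2 + 1) (by omega) (by omega) (by omega) hf'
          rw [this] at hf
          exact absurd hf (by decide)
        have hcode : code (sideAt bStar) (run i (j - i)) = runCode 0 2 1 := by
          have hr' : run 0 2 = [0, 3] := by decide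
          rw [hr, runCode, hr']
          have ha : sideAt (zeroAt 1) 0 = true := by decide
          have hb : sideAt (zeroAt 1) 3 = true := by decide
          refine code_congr rfl ?_ ?_
          · intro t ht
            have : t = 0 ∨ t = 1 := by simp at ht; omega
            rcases this with rfl | rfl
            · exact htrue.1.trans ha.symm
            · exact htrue.2.trans hb.symm
          · intro t t' htt ht
            obtain ⟨rfl, rfl⟩ : t = 0 ∧ t' = 1 := by simp at ht; omega
            change Inv _ (i + 1) (i + 2) ↔ Inv _ 0 3
            unfold Inv
            rw [hside, ha, hb]
            simp
            omega
        refine ⟨j - i, hmem, _, ?_, _, htail, hsplit.2.symm⟩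
        rw [Finset.mem_union, hcode, show j - i = 2 by omega]
        exact Or.inl (runCode_mem_items (by omega) (by omega) (by omega) (Or.inl rfl))
      -- On different sides there is no inversion, and the lower point alone is an item of length 1.
      · have hl' : l = [i + 1] ++ ((i + 2) :: l₂) := by
          have := hsplit.1
          rw [hr] at this
          simpa using this
        have hr1 : [i + 1] = run (i + 1) 1 := by
          refine List.Pairwise.eq_of_mem_iff (r := (· < ·)) (by simp) (pairwise_run _ _) fun q => ?_
          rw [mem_run]
          simp only [List.mem_cons, List.not_mem_nil, or_false]
          omega
        have hone : AtMostOneZero bStar (i + 1) 1 := by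
          intro z z' h1 h2 h3
          omega
        obtain ⟨z, hz1, hz2⟩ := exists_code_run_eq Nat.one_pos hone
        refine ⟨1, Finset.mem_Icc.mpr (by omega), code (sideAt bStar) [i + 1], ?_,
          code (sideAt bStar) ((i + 2) :: l₂), ?_, ?_⟩
        · rw [Finset.mem_union, hr1, hz2]
          exact Or.inl (runCode_mem_items (by omega) (by omega) hz1 (Or.inr (by omega)))
        · refine ⟨(i + 2) :: l₂, ?_, ?_, ?_, rfl⟩
          · rw [hl'] at hl
            exact (List.pairwise_append.mp hl).2.1
          · intro q hq
            exact (by omega : N + 2 * (q % 2) ≤ i + 2 * (q % 2)).trans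
              (hi2 q (by rw [hl']; exact List.mem_append_right _ hq))
          · rw [List.length_cons]; omega
        · rw [← code_append, ← hl']
          intro p hp q hq hinv
          obtain rfl := List.mem_singleton.mp hp
          rcases List.mem_cons.mp hq with rfl | hq
          · exact hside hinv.2.2
          · have h1 := hl₂' q hq
            have h2 := hinv.1
            have h3 := hinv.2.1
            omega
  · refine ⟨j - i, hmem, _, ?_, _, htail, hsplit.2.symm⟩
    rw [Finset.mem_union]
    exact Or.inr (code_run_mem_longItems hNi hz)

theorem ncard_tailCodes_le (N : ℕ) {n : ℕ} (hn : 0 < n) :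
    (tailCodes bStar N n).ncard ≤ ∑ k ∈ Finset.Icc 1 n,
      (itemCount k + if N ≤ k ^ 2 then k ^ 2 + 1 else 0) * (tailCodes bStar N (n - k)).ncard := by
  have e : ∀ m, (tailCodes bStar N m).ncard = (finite_tailCodes bStar N m).toFinset.card :=
    fun m => Set.ncard_eq_toFinset_card _ _
  have hsub : (finite_tailCodes bStar N n).toFinset ⊆ (Finset.Icc 1 n).biUnion fun k =>
      Finset.image₂ (· ++ ·) (items k ∪ longItems N k)
        (finite_tailCodes bStar N (n - k)).toFinset := by
    intro v hv
    rw [Set.Finite.mem_toFinset] at hv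
    obtain ⟨k, hk, x, hx, v', hv', rfl⟩ := exists_append_of_mem_tailCodes hn hv
    rw [Finset.mem_biUnion]
    exact ⟨k, hk, Finset.mem_image₂_of_mem hx ((Set.Finite.mem_toFinset _).mpr hv')⟩
  rw [e]
  refine (Finset.card_le_card hsub).trans (Finset.card_biUnion_le.trans ?_)
  refine Finset.sum_le_sum fun k hk => ?_
  rw [Finset.mem_Icc] at hk
  refine (Finset.card_image₂_le _ _ _).trans ?_
  rw [e]
  refine Nat.mul_le_mul_right _ ((Finset.card_union_le _ _).trans ?_)
  rw [card_items (by omega)]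
  exact Nat.add_le_add_left (card_longItems_le N k) _

/-! ### All codes -/

/-- The places of a set `P` of places and of the pins `N, …, N + r - 1`. -/
def withRun (P : Finset ℕ) (N r : ℕ) : List ℕ :=
  (List.range (N + r + 2)).filter fun q => q ∈ P ∨ q ∈ run N r

/-- The code is cut at the first missing pin from `N` on. Below it lie the chosen pins before `N`,
with places less than `N + 2`, and a run from `N`, whose length is determined by the other data. -/
theorem exists_append_of_mem_classCodes (N : ℕ) {n : ℕ} {v : List CodeLetter}
    (hv : v ∈ classCodes bStar n) :
    ∃ P ∈ (Finset.range (N + 2)).powerset, ∃ m ∈ Finset.range (n + 1),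
      ∃ v' ∈ tailCodes bStar N m,
        code (sideAt bStar) (withRun P N (n - m - P.card)) ++ v' = v := by
  obtain ⟨l, hl, h1, hlen, rfl⟩ := hv
  obtain ⟨j, hNj, hj, hij'⟩ := exists_missing l N
  have hsplit := split_at_missing hl h1 hj (sideAt bStar)
  have hrun : l.filter (fun q => N + 2 * (q % 2) ≤ q ∧ q < j + 2 * (q % 2)) = run N (j - N) := by
    refine (hl.filter _).eq_of_mem_iff (pairwise_run _ _) fun q => ?_
    rw [List.mem_filter, decide_eq_true_eq, mem_run]
    constructor
    · rintro ⟨h1, h2⟩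
      omega
    · rintro ⟨h1, h2⟩
      refine ⟨?_, by omega⟩
      rw [← toPlace_pinAt (q := q) (by omega)]
      exact hij' _ (by unfold pinAt; omega) (by unfold pinAt; omega)
  set P : Finset ℕ := (l.filter fun q => q < N + 2 * (q % 2)).toFinset with hP
  have hPcard : P.card = (l.filter fun q => q < N + 2 * (q % 2)).length :=
    List.toFinset_card_of_nodup (nodup_of_pairwise (hl.filter _))
  have hPmem : ∀ q, q ∈ P ↔ q ∈ l ∧ q < N + 2 * (q % 2) := by
    intro q
    rw [hP, List.mem_toFinset, List.mem_filter, decide_eq_true_eq]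
  have hlen1 : (l.filter fun q => q < j + 2 * (q % 2)).length = P.card + (j - N) := by
    rw [hPcard, ← length_run N (j - N), ← hrun, ← List.length_append]
    refine List.Perm.length_eq ?_
    rw [List.perm_ext_iff_of_nodup (nodup_of_pairwise (hl.filter _))]
    · intro q
      simp only [List.mem_append, List.mem_filter, decide_eq_true_eq]
      constructor
      · rintro ⟨ha, hb⟩
        by_cases hc : q < N + 2 * (q % 2)
        · exact Or.inl ⟨ha, hc⟩
        · exact Or.inr ⟨ha, by omega, hb⟩
      · rintro (⟨ha, hb⟩ | ⟨ha, hb, hc⟩)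
        · exact ⟨ha, by omega⟩
        · exact ⟨ha, hc⟩
    · rw [List.nodup_append]
      refine ⟨nodup_of_pairwise (hl.filter _), nodup_of_pairwise (hl.filter _), ?_⟩
      intro p hp q hq
      rw [List.mem_filter, decide_eq_true_eq] at hp hq
      rintro rfl
      omega
  have hwith : withRun P N (j - N) = l.filter (fun q => q < j + 2 * (q % 2)) := by
    refine (List.pairwise_lt_range.filter _).eq_of_mem_iff (hl.filter _) fun q => ?_
    rw [List.mem_filter, List.mem_range, List.mem_filter, decide_eq_true_eq, decide_eq_true_eq,
      hPmem, ← hrun, List.mem_filter, decide_eq_true_eq]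
    constructor
    · rintro ⟨_, ⟨ha, hb⟩ | ⟨ha, hb, hc⟩⟩
      · exact ⟨ha, by omega⟩
      · exact ⟨ha, hc⟩
    · rintro ⟨ha, hb⟩
      refine ⟨by omega, ?_⟩
      by_cases hc : q < N + 2 * (q % 2)
      · exact Or.inl ⟨ha, hc⟩
      · exact Or.inr ⟨ha, by omega, hb⟩
  have hlen2 := congrArg List.length hsplit.1
  rw [List.length_append, hlen1] at hlen2
  refine ⟨P, ?_, (l.filter fun q => j + 1 + 2 * (q % 2) ≤ q).length, ?_, _,
    ⟨_, hl.filter _, ?_, rfl, rfl⟩, ?_⟩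
  · rw [Finset.mem_powerset]
    intro q hq
    rw [hPmem] at hq
    rw [Finset.mem_range]
    omega
  · rw [Finset.mem_range]; omega
  · intro q hq
    rw [List.mem_filter, decide_eq_true_eq] at hq
    omega
  · rw [hsplit.2, ← hwith]
    congr 3
    omega

theorem ncard_classCodes_le (N n : ℕ) :
    (classCodes bStar n).ncard ≤
      2 ^ (N + 2) * ∑ m ∈ Finset.range (n + 1), (tailCodes bStar N m).ncard := by
  have e : ∀ m, (tailCodes bStar N m).ncard = (finite_tailCodes bStar N m).toFinset.card :=
    fun m => Set.ncard_eq_toFinset_card _ _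
  have hsub : (finite_classCodes bStar n).toFinset ⊆
      (Finset.range (N + 2)).powerset.biUnion fun P => (Finset.range (n + 1)).biUnion fun m =>
        (finite_tailCodes bStar N m).toFinset.image
          (code (sideAt bStar) (withRun P N (n - m - P.card)) ++ ·) := by
    intro v hv
    rw [Set.Finite.mem_toFinset] at hv
    obtain ⟨P, hP, m, hm, v', hv', rfl⟩ := exists_append_of_mem_classCodes N hv
    rw [Finset.mem_biUnion]
    refine ⟨P, hP, Finset.mem_biUnion.mpr ⟨m, hm, Finset.mem_image.mpr ⟨v', ?_, rfl⟩⟩⟩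
    exact (Set.Finite.mem_toFinset _).mpr hv'
  rw [Set.ncard_eq_toFinset_card _ (finite_classCodes bStar n)]
  refine (Finset.card_le_card hsub).trans ?_
  have hcard : 2 ^ (N + 2) = (Finset.range (N + 2)).powerset.card := by simp
  rw [hcard]
  refine Finset.card_biUnion_le_card_mul _ _ _ fun P _ => ?_
  refine Finset.card_biUnion_le.trans (Finset.sum_le_sum fun m _ => ?_)
  rw [e]
  exact Finset.card_image_le

open Filter Topology

/-! ### Growth rates from recursions -/

theorem le_pow_of_le_sum {t : ℕ → ℕ} {H : ℕ → ℕ} {ν : ℝ} (hν : 0 < ν) (h0 : t 0 ≤ 1)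
    (ht : ∀ n, 0 < n → t n ≤ ∑ k ∈ Finset.Icc 1 n, H k * t (n - k))
    (hH : ∀ n, ∑ k ∈ Finset.Icc 1 n, (H k : ℝ) * ν⁻¹ ^ k ≤ 1) (n : ℕ) : (t n : ℝ) ≤ ν ^ n := by
  induction n using Nat.strong_induction_on with
  | _ n ih =>
    rcases Nat.eq_zero_or_pos n with rfl | hn
    · simpa using h0
    · have h1 : (t n : ℝ) ≤ ∑ k ∈ Finset.Icc 1 n, (H k : ℝ) * t (n - k) := by
        exact_mod_cast ht n hn
      refine h1.trans ?_
      calc ∑ k ∈ Finset.Icc 1 n, (H k : ℝ) * t (n - k)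
          ≤ ∑ k ∈ Finset.Icc 1 n, ν ^ n * ((H k : ℝ) * ν⁻¹ ^ k) := by
            refine Finset.sum_le_sum fun k hk => ?_
            rw [Finset.mem_Icc] at hk
            have h2 := ih (n - k) (by omega)
            have h3 : ν ^ (n - k) = ν ^ n * ν⁻¹ ^ k := by
              rw [inv_pow, pow_sub₀ _ hν.ne' hk.2]
            rw [h3] at h2
            calc (H k : ℝ) * t (n - k) ≤ (H k : ℝ) * (ν ^ n * ν⁻¹ ^ k) :=
                  mul_le_mul_of_nonneg_left h2 (Nat.cast_nonneg _)
              _ = _ := by ring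
        _ = ν ^ n * ∑ k ∈ Finset.Icc 1 n, (H k : ℝ) * ν⁻¹ ^ k := by rw [Finset.mul_sum]
        _ ≤ ν ^ n * 1 := mul_le_mul_of_nonneg_left (hH n) (by positivity)
        _ = ν ^ n := mul_one _

/-- The factor `r⁻¹ ^ K` makes the bound at most 1 for `n < K`, where `1 ≤ a n` suffices; from `K`
on the first `K` terms of the recursion carry the induction. -/
theorem mul_pow_le_of_sum_le {a : ℕ → ℕ} {H : ℕ → ℕ} {r : ℝ} {K : ℕ} (hr : 1 ≤ r)
    (h0 : 1 ≤ a 0) (h1 : 1 ≤ H 1)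
    (ha : ∀ n, ∑ k ∈ Finset.Icc 1 n, H k * a (n - k) ≤ a n)
    (hH : 1 ≤ ∑ k ∈ Finset.Icc 1 K, (H k : ℝ) * r⁻¹ ^ k) (n : ℕ) :
    r⁻¹ ^ K * r ^ n ≤ a n := by
  have hr0 : 0 < r := by linarith
  have hpos : ∀ n, 1 ≤ a n := by
    intro n
    induction n with
    | zero => exact h0
    | succ n ih =>
      have h2 : H 1 * a (n + 1 - 1) ≤ ∑ k ∈ Finset.Icc 1 (n + 1), H k * a (n + 1 - k) :=
        Finset.single_le_sum (f := fun k => H k * a (n + 1 - k)) (fun _ _ => Nat.zero_le _)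
          (Finset.mem_Icc.mpr (by omega))
      refine le_trans ?_ (h2.trans (ha (n + 1)))
      exact Nat.mul_le_mul h1 ih
  induction n using Nat.strong_induction_on with
  | _ n ih =>
    rcases Nat.lt_or_ge n K with hn | hn
    · have h2 : r⁻¹ ^ K * r ^ n ≤ 1 := by
        rw [inv_pow, inv_mul_le_iff₀ (by positivity), mul_one]
        exact pow_le_pow_right₀ hr hn.le
      exact h2.trans (by exact_mod_cast hpos n)
    · have h2 : ∑ k ∈ Finset.Icc 1 n, (H k : ℝ) * a (n - k) ≤ a n := by exact_mod_cast ha n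
      refine le_trans ?_ h2
      have h3 : ∑ k ∈ Finset.Icc 1 K, (H k : ℝ) * a (n - k) ≤
          ∑ k ∈ Finset.Icc 1 n, (H k : ℝ) * a (n - k) :=
        Finset.sum_le_sum_of_subset_of_nonneg (Finset.Icc_subset_Icc le_rfl hn)
          fun _ _ _ => by positivity
      refine le_trans ?_ h3
      calc r⁻¹ ^ K * r ^ n = r⁻¹ ^ K * r ^ n * 1 := (mul_one _).symm
        _ ≤ r⁻¹ ^ K * r ^ n * ∑ k ∈ Finset.Icc 1 K, (H k : ℝ) * r⁻¹ ^ k :=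
          mul_le_mul_of_nonneg_left hH (by positivity)
        _ = ∑ k ∈ Finset.Icc 1 K, r⁻¹ ^ K * r ^ n * ((H k : ℝ) * r⁻¹ ^ k) := Finset.mul_sum _ _ _
        _ ≤ _ := by
          refine Finset.sum_le_sum fun k hk => ?_
          rw [Finset.mem_Icc] at hk
          have h4 := ih (n - k) (by omega)
          have h5 : r ^ (n - k) = r ^ n * r⁻¹ ^ k := by
            rw [inv_pow, pow_sub₀ _ hr0.ne' (by omega)]
          rw [h5] at h4
          calc r⁻¹ ^ K * r ^ n * ((H k : ℝ) * r⁻¹ ^ k)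
              = (H k : ℝ) * (r⁻¹ ^ K * (r ^ n * r⁻¹ ^ k)) := by ring
            _ ≤ _ := mul_le_mul_of_nonneg_left h4 (Nat.cast_nonneg _)

theorem tendsto_const_mul_pow_root {c r : ℝ} (hc : 0 < c) (hr : 0 < r) :
    Tendsto (fun n : ℕ => (c * r ^ n) ^ (1 / (n : ℝ))) atTop (𝓝 r) := by
  have h1 : Tendsto (fun n : ℕ => c ^ (1 / (n : ℝ)) * r) atTop (𝓝 (c ^ (0 : ℝ) * r)) :=
    ((Real.continuousAt_const_rpow hc.ne').tendsto.comp
      tendsto_one_div_atTop_nhds_zero_nat).mul_const r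
  rw [Real.rpow_zero, one_mul] at h1
  refine h1.congr' ?_
  filter_upwards [eventually_gt_atTop 0] with n hn
  rw [Real.mul_rpow hc.le (by positivity), one_div, Real.pow_rpow_inv_natCast hr.le (by omega)]

theorem tendsto_root_of_bounds {u : ℕ → ℝ} {μ m : ℝ} (hm : 0 < m) (hμ : m < μ)
    (hlow : ∀ r, m < r → r < μ → ∃ c, 0 < c ∧ ∀ n, c * r ^ n ≤ u n)
    (hup : ∀ r, μ < r → ∃ c, 0 < c ∧ ∀ n, u n ≤ c * r ^ n) :
    Tendsto (fun n : ℕ => u n ^ (1 / (n : ℝ))) atTop (𝓝 μ) := by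
  have hpos : ∀ n, 0 ≤ u n := by
    intro n
    obtain ⟨c, hc, h⟩ := hlow ((m + μ) / 2) (by linarith) (by linarith)
    exact le_trans (mul_nonneg hc.le (pow_nonneg (by linarith) _)) (h n)
  rw [tendsto_order]
  constructor
  · intro a ha
    obtain ⟨r, hr1, hr2⟩ := exists_between (max_lt ha hμ)
    have hr3 : m < r := lt_of_le_of_lt (le_max_right _ _) hr1
    obtain ⟨c, hc, h⟩ := hlow r hr3 hr2
    have hr0 : 0 < r := hm.trans hr3
    filter_upwards [(tendsto_const_mul_pow_root hc hr0).eventually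
      (lt_mem_nhds (lt_of_le_of_lt (le_max_left _ _) hr1))] with n hn
    exact hn.trans_le (Real.rpow_le_rpow (by positivity) (h n) (by positivity))
  · intro a ha
    obtain ⟨r, hr1, hr2⟩ := exists_between ha
    obtain ⟨c, hc, h⟩ := hup r hr1
    have hr0 : 0 < r := by linarith
    filter_upwards [(tendsto_const_mul_pow_root hc hr0).eventually (gt_mem_nhds hr2)] with n hn
    exact lt_of_le_of_lt (Real.rpow_le_rpow (hpos n) (h n) (by positivity)) hn

/-! ### The generating function of the items -/

theorem hasSum_itemCount {x : ℝ} (h0 : 0 < x) (h1 : x < 1) :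
    HasSum (fun k : ℕ => if k = 0 then 0 else (itemCount k : ℝ) * x ^ k)
      (1 - (1 - 4 * x + 3 * x ^ 2 - 2 * x ^ 3 - x ^ 4 + 2 * x ^ 5) / (1 - x) ^ 2) := by
  have hx : ‖x‖ < 1 := by rwa [Real.norm_of_nonneg h0.le]
  have s1 := hasSum_coe_mul_geometric_of_norm_lt_one hx
  have s2 := (hasSum_geometric_of_lt_one h0.le h1).mul_left 3
  -- The correction of `(k + 3) * x ^ k` for `k ≤ 3`.
  let c : ℕ → ℝ := fun k =>
    if k = 0 then 3 else if k = 1 then 2 * x else if k = 2 then 3 * x ^ 2 else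
      if k = 3 then 2 * x ^ 3 else 0
  have s3 : HasSum c (∑ k ∈ Finset.range 4, c k) := by
    refine hasSum_sum_of_ne_finset_zero fun k hk => ?_
    rw [Finset.mem_range] at hk
    simp only [c]
    rw [if_neg (by omega), if_neg (by omega), if_neg (by omega), if_neg (by omega)]
  have s4 := (s1.add s2).sub s3
  have hne : (1 - x) ≠ 0 := by linarith
  have e1 : (fun k : ℕ => if k = 0 then 0 else (itemCount k : ℝ) * x ^ k) =
      fun k : ℕ => k * x ^ k + 3 * x ^ k - c k := by
    funext k
    simp only [c, itemCount]
    by_cases hk : k ≤ 3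
    · interval_cases k <;> norm_num <;> ring
    · rw [if_neg (by omega), if_neg (by omega), if_neg (by omega), if_neg (by omega),
        if_neg (by omega), if_neg (by omega), if_neg (by omega)]
      push_cast
      ring
  have e2 : 1 - (1 - 4 * x + 3 * x ^ 2 - 2 * x ^ 3 - x ^ 4 + 2 * x ^ 5) / (1 - x) ^ 2 =
      x / (1 - x) ^ 2 + 3 * (1 - x)⁻¹ - ∑ k ∈ Finset.range 4, c k := by
    simp only [c, Finset.sum_range_succ, Finset.sum_range_zero]
    norm_num
    field_simp
    ring
  rw [e1, e2]
  exact s4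

/-- The polynomial whose largest zero is the growth rate. -/
def growthPoly (z : ℝ) : ℝ := z ^ 5 - 4 * z ^ 4 + 3 * z ^ 3 - 2 * z ^ 2 - z + 2

/-- Expanded at 3, the polynomial has positive coefficients except for the constant term. So a zero
above 3 is the largest one. -/
theorem growthPoly_lt {x y : ℝ} (hx : 3 ≤ x) (hxy : x < y) : growthPoly x < growthPoly y := by
  have e : ∀ z, growthPoly z = (z - 3) ^ 5 + 11 * (z - 3) ^ 4 + 45 * (z - 3) ^ 3 +
      79 * (z - 3) ^ 2 + 41 * (z - 3) - 19 := by
    intro z; unfold growthPoly; ring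
  rw [e, e]
  have h0 : 0 ≤ x - 3 := by linarith
  have h1 : x - 3 < y - 3 := by linarith
  gcongr

theorem exists_growthPoly_eq_zero : ∃ μ, 3 < μ ∧ growthPoly μ = 0 := by
  have hc : ContinuousOn growthPoly (Set.Icc 3 4) := by
    unfold growthPoly; fun_prop
  have h := intermediate_value_Icc (by norm_num : (3 : ℝ) ≤ 4) hc
  obtain ⟨μ, hμ, h0⟩ := h (show (0 : ℝ) ∈ _ by
    constructor <;> unfold growthPoly <;> norm_num)
  refine ⟨μ, lt_of_le_of_ne hμ.1 ?_, h0⟩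
  rintro rfl
  unfold growthPoly at h0
  norm_num at h0

/-- In this form the sign of `growthPoly r` decides whether the sum is above or below 1. -/
theorem hasSum_itemCount_inv {r : ℝ} (hr : 1 < r) :
    HasSum (fun k : ℕ => if k = 0 then 0 else (itemCount k : ℝ) * r⁻¹ ^ k)
      (1 - growthPoly r / (r ^ 3 * (r - 1) ^ 2)) := by
  have h := hasSum_itemCount (x := r⁻¹) (by positivity) (inv_lt_one_of_one_lt₀ hr)
  convert h using 2
  have h1 : r ≠ 0 := by linarith
  have h2 : r - 1 ≠ 0 := by linarith
  have h4 : 1 - r⁻¹ = (r - 1) / r := by field_simp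
  rw [h4]
  unfold growthPoly
  field_simp

theorem sum_Icc_eq (f : ℕ → ℝ) (n : ℕ) :
    ∑ k ∈ Finset.Icc 1 n, f k = ∑ k ∈ Finset.range (n + 1), if k = 0 then 0 else f k := by
  rw [Finset.range_eq_Ico, Finset.sum_eq_sum_Ico_succ_bot (by omega), if_pos rfl, zero_add]
  refine Finset.sum_congr ?_ fun k hk => ?_
  · ext k
    simp only [Finset.mem_Icc, Finset.mem_Ico]
    omega
  · rw [Finset.mem_Ico] at hk
    rw [if_neg (by omega)]

theorem exists_one_le_sum_itemCount {r : ℝ} (hr : 1 < r) (hp : growthPoly r < 0) :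
    ∃ K, 1 ≤ ∑ k ∈ Finset.Icc 1 K, (itemCount k : ℝ) * r⁻¹ ^ k := by
  have h := (hasSum_itemCount_inv hr).tendsto_sum_nat
  have hlt : 1 < 1 - growthPoly r / (r ^ 3 * (r - 1) ^ 2) := by
    have : growthPoly r / (r ^ 3 * (r - 1) ^ 2) < 0 :=
      div_neg_of_neg_of_pos hp (by
        have : 0 < r - 1 := by linarith
        positivity)
    linarith
  obtain ⟨K, hK⟩ := (((tendsto_add_atTop_iff_nat 1).mpr h).eventually (lt_mem_nhds hlt)).exists
  exact ⟨K, by rw [sum_Icc_eq]; exact hK.le⟩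

theorem exists_sum_le_one {r : ℝ} (hr : 1 < r) (hp : 0 < growthPoly r) :
    ∃ N, ∀ n, ∑ k ∈ Finset.Icc 1 n,
      ((itemCount k + if N ≤ k ^ 2 then k ^ 2 + 1 else 0 : ℕ) : ℝ) * r⁻¹ ^ k ≤ 1 := by
  have h := hasSum_itemCount_inv hr
  have hx0 : 0 < r⁻¹ := by positivity
  have hε : 0 < growthPoly r / (r ^ 3 * (r - 1) ^ 2) := by
    have : 0 < r - 1 := by linarith
    positivity
  have hx : ‖r⁻¹‖ < 1 := by
    rw [Real.norm_of_nonneg hx0.le]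
    exact inv_lt_one_of_one_lt₀ hr
  let f : ℕ → ℝ := fun k => ((k : ℝ) ^ 2 + 1) * r⁻¹ ^ k
  have hf0 : ∀ k, 0 ≤ f k := fun k => by positivity
  have hf : Summable f := by
    have h1 := summable_pow_mul_geometric_of_norm_lt_one 2 hx
    have h2 := summable_geometric_of_norm_lt_one hx
    refine (h1.add h2).congr fun k => ?_
    simp only [f]; ring
  obtain ⟨K, hK⟩ := (hf.hasSum.tendsto_sum_nat.eventually
    (lt_mem_nhds (sub_lt_self (tsum f) hε))).exists
  -- With `N = K ^ 2` long items start at length `K`, and the tail of `f` from there on is below the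
  -- slack that the items leave under 1.
  refine ⟨K ^ 2, fun n => ?_⟩
  have e : ∀ k : ℕ, ((itemCount k + if K ^ 2 ≤ k ^ 2 then k ^ 2 + 1 else 0 : ℕ) : ℝ) * r⁻¹ ^ k =
      (itemCount k : ℝ) * r⁻¹ ^ k + if K ≤ k then f k else 0 := by
    intro k
    simp only [Nat.pow_le_pow_iff_left (two_ne_zero)]
    split_ifs
    · simp only [f]; push_cast; ring
    · simp
  simp only [e]
  rw [Finset.sum_add_distrib, ← Finset.sum_filter]
  have h1 : ∑ k ∈ Finset.Icc 1 n, (itemCount k : ℝ) * r⁻¹ ^ k ≤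
      1 - growthPoly r / (r ^ 3 * (r - 1) ^ 2) := by
    rw [sum_Icc_eq]
    refine sum_le_hasSum _ (fun k _ => ?_) h
    split_ifs
    · exact le_rfl
    · positivity
  have h2 : ∑ k ∈ Finset.range K, f k + ∑ k ∈ (Finset.Icc 1 n).filter (K ≤ ·), f k ≤ tsum f := by
    rw [← Finset.sum_union]
    · exact hf.sum_le_tsum _ fun k _ => hf0 k
    · rw [Finset.disjoint_left]
      intro k hk hk'
      rw [Finset.mem_range] at hk
      rw [Finset.mem_filter] at hk'
      omega
  linarith

/-! ### The growth rate -/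

theorem sum_pow_le {r : ℝ} (hr : 2 ≤ r) (n : ℕ) :
    ∑ m ∈ Finset.range (n + 1), r ^ m ≤ 2 * r ^ n := by
  induction n with
  | zero => simp
  | succ n ih =>
    rw [Finset.sum_range_succ]
    have h : 2 * r ^ n ≤ r ^ (n + 1) := by
      rw [pow_succ']
      exact mul_le_mul_of_nonneg_right hr (by positivity)
    linarith

theorem hasGrowthRate_wStar {μ : ℝ} (h3 : 3 < μ) (hμ : growthPoly μ = 0) :
    HasGrowthRate (pinClass wStar) μ := by
  unfold HasGrowthRate wStar
  simp only [ncard_pinClass]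
  refine tendsto_root_of_bounds (m := 3) (by norm_num) h3 ?_ ?_
  · intro r hr1 hr2
    have hp : growthPoly r < 0 := hμ ▸ growthPoly_lt hr1.le hr2
    obtain ⟨K, hK⟩ := exists_one_le_sum_itemCount (by linarith) hp
    refine ⟨r⁻¹ ^ K, by positivity, fun n => ?_⟩
    have h1 : 1 ≤ (farCodes 0).ncard :=
      (Set.ncard_pos (finite_farCodes 0)).mpr ⟨_, nil_mem_farCodes⟩
    refine (mul_pow_le_of_sum_le (a := fun n => (farCodes n).ncard) (H := itemCount) (by linarith)
      h1 (by decide) sum_mul_ncard_farCodes_le hK n).trans ?_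
    exact_mod_cast Set.ncard_le_ncard (farCodes_subset n) (finite_classCodes _ n)
  · intro r hr
    have hp : 0 < growthPoly r := hμ ▸ growthPoly_lt h3.le hr
    obtain ⟨N, hN⟩ := exists_sum_le_one (by linarith) hp
    -- The last factor 2 bounds the geometric sum over the length of the tail.
    refine ⟨2 ^ (N + 2) * 2, by positivity, fun n => ?_⟩
    have h0 : (tailCodes bStar N 0).ncard ≤ 1 := by
      rw [Set.ncard_le_one_iff_subset_singleton (finite_tailCodes _ _ _)]
      refine ⟨[], ?_⟩
      rintro v ⟨l, -, -, hl, rfl⟩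
      rw [Set.mem_singleton_iff, ← List.length_eq_zero_iff, length_code, hl]
    have ht := le_pow_of_le_sum (t := fun n => (tailCodes bStar N n).ncard) (ν := r) (by linarith)
      h0 (fun n hn => ncard_tailCodes_le N hn) hN
    have h1 : ((classCodes bStar n).ncard : ℝ) ≤
        2 ^ (N + 2) * ∑ m ∈ Finset.range (n + 1), ((tailCodes bStar N m).ncard : ℝ) := by
      exact_mod_cast ncard_classCodes_le N n
    refine h1.trans ?_
    rw [mul_assoc]
    refine mul_le_mul_of_nonneg_left ?_ (by positivity)
    exact (Finset.sum_le_sum fun m _ => ht m).trans (sum_pow_le (by linarith) n)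

end Pin

theorem proposition5p3 :
    Pin.IsPinSequence Pin.wStar ∧
    ¬ Pin.Recurrent Pin.wStar ∧
    ¬ Pin.EventuallyRecurrent Pin.wStar ∧
    Pin.boxInterior Pin.wStar ⊆ Pin.pinClass Pin.wStar ∧
    Pin.boxInterior Pin.wStar =
      Pin.boxClosure {σ | ∃ (k l : ℕ) (f : List Pin.PinLetter),
        f <:+: Pin.phi (List.replicate k true ++ [false] ++ List.replicate l true) ∧
        σ = Pin.pinPerm f} ∧
    ∃ μ : ℝ,
      IsGreatest {x : ℝ | x ^ 5 - 4 * x ^ 4 + 3 * x ^ 3 - 2 * x ^ 2 - x + 2 = 0} μ ∧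
      Pin.HasGrowthRate (Pin.pinClass Pin.wStar) μ := by
  obtain ⟨μ, h3, hμ⟩ := Pin.exists_growthPoly_eq_zero
  refine ⟨Pin.isPinSequence_phiSeq _, Pin.not_recurrent_wStar, Pin.not_eventuallyRecurrent_wStar,
    Pin.boxInterior_subset_pinClass _, Pin.boxInterior_wStar, μ, ⟨hμ, fun x hx => ?_⟩,
    Pin.hasGrowthRate_wStar h3 hμ⟩
  by_contra hc
  have h1 := Pin.growthPoly_lt h3.le (not_le.mp hc)
  rw [hμ] at h1
  exact h1.ne' hx
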